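/- \textbf{Setting.} A skew shape $\lambda/\mu$ is a pair of weakly decreasing integer sequences $\lambda=(\lambda_1,\dots,\lambda_r)$, $\mu=(\mu_1,\dots,\mu_r)$ of the same length $r\ge 0$. For $N\ge 0$, $s_{\lambda/\mu}=s_{\lambda/\mu}(x_1,\dots,x_N)$ is the generating function of the semistandard tableaux of shape $\lambda/\mu$ with entries in $\{1,\dots,N\}$, and $s_{\lambda/\mu}=0$ if $\mu_i>\lambda_i$ for some $i$. The shape $\lambda/\mu$ has the lower points with abscissas $\mu_i-i$ and the upper points with abscissas $\lambda_i-i$ ($1\le i\le r$); these points determine the shape. Let $\lambda/\mu$ and $\sigma/\tau$ be two skew shapes (possibly with different numbers of rows). A point is \emph{coloured} if it belongs to exactly one of the two shapes and \emph{uncoloured} if it belongs to both. A \emph{radial orientation} orients every coloured point inwards or outwards; it is \emph{admissible} if as many points are oriented inwards as outwards. Lower inward and upper outward points are called green, the other coloured points red. An admissible radial orientation $v$ corresponds to the pair of skew shapes $(\lambda_v/\mu_v,\sigma_v/\tau_v)$ whose first shape has as points the green and the uncoloured points, and whose second shape has as points the red and the uncoloured points. The given pair $(\lambda/\mu,\sigma/\tau)$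 itself corresponds to the orientation in which the coloured points of $\lambda/\mu$ are green and those of $\sigma/\tau$ are red. Place the coloured points on a circle, first the lower points from left to right, then the upper points from right to left. A \emph{noncrossing oriented perfect matching} of an admissible orientation is a perfect matching of the coloured points by pairwise noncrossing chords such that each chord joins an inward and an outward point. Let $S$ be a nonempty set of coloured points which all have the same orientation in the radial orientation of $(\lambda/\mu,\sigma/\tau)$. The \emph{Dodgson recolouring scheme} reverses, for an orientation and a noncrossing oriented perfect matching of it, the orientation of both end points of every matching edge incident with a point of $S$. Let $G$ be the graph whose vertices are the admissible radial orientations in which all points of $S$ have the same orientation, two vertices being adjacent if one arises from the other by the Dodgson recolouring scheme for some noncrossing oriented perfect matching. Let $I$ (respectively $O$) be the set of vertices in which all points of $S$ are oriented inwards (respectively outwards). \textbf{Lemma.} The graph $G$ is bipartite with bipartition classes $I$ and $O$: every vertex lies in exactly one of $I$, $O$, and every edge joins a vertex of $I$ and a vertex of $O$. For every connected component $Z$ of $G$ with at least two vertices (the absence of such a component is the degenerate case), $Z\cap I$ and $Z\cap O$ are nonempty and, for every number $N\ge 0$ of variables, $$\sum_{v\in Z\cap I}s_{\lambda_v/\mu_v}\cdot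 s_{\sigma_v/\tau_v}=\sum_{v\in Z\cap O}s_{\lambda_v/\mu_v}\cdot s_{\sigma_v/\tau_v}.$$ -/

import Mathlib

namespace DodgsonScheme

/-! ### Skew shapes and skew Schur functions -/

/-- A (formal) skew shape `outer / inner` with `rows` rows: a pair of weakly decreasing sequences of
integers of the same length. Entries may be negative, and containment of `inner` in `outer` is not
part of the structure: the skew Schur function vanishes when it fails. -/
structure SkewShape where
  rows : ℕ
  outer : Fin rows → ℤ
  inner : Fin rows → ℤ
  outer_antitone : Antitone outer
  inner_antitone : Antitone inner

namespace SkewShape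

/-- The cells `(i, j)` of the shape, `inner i < j ≤ outer i`. -/
noncomputable def cells (A : SkewShape) : Finset (Fin A.rows × ℤ) :=
  Finset.univ.biUnion fun i => (Finset.Ioc (A.inner i) (A.outer i)).image fun j => (i, j)

/-- Semistandard fillings: weakly increasing along rows, strictly increasing down columns. -/
def IsSemistandard (A : SkewShape) {n : ℕ} (T : A.cells → Fin n) : Prop :=
  (∀ p q : A.cells, p.1.1 = q.1.1 → p.1.2 ≤ q.1.2 → T p ≤ T q) ∧
  (∀ p q : A.cells, p.1.2 = q.1.2 → p.1.1 < q.1.1 → T p < T q)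

open Classical in
/-- The skew Schur function of the shape in the variables `X 0, …, X (n - 1)`: the generating
function of the semistandard tableaux of that shape with entries in `Fin n`; it is `0` if the inner
partition is not contained in the outer one. -/
noncomputable def schur (n : ℕ) (A : SkewShape) : MvPolynomial (Fin n) ℤ :=
  if ∀ i, A.inner i ≤ A.outer i then
    ∑ T : A.cells → Fin n with A.IsSemistandard T, ∏ c : A.cells, MvPolynomial.X (T c)
  else 0

end SkewShape

/-! ### Lower and upper points -/

/-- Starting and ending points of lattice paths: `Sum.inl x` is the lower point with abscissa `x`,
`Sum.inr x` is the upper point with abscissa `x`. -/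
abbrev Point : Type := ℤ ⊕ ℤ

/-- The order in which points are met on the boundary circle, cut open to the left of all the
points: the lower points from left to right, then the upper points from right to left. -/
def Precedes : Point → Point → Prop
  | .inl x, .inl y => x < y
  | .inl _, .inr _ => True
  | .inr _, .inl _ => False
  | .inr x, .inr y => y < x

namespace SkewShape

/-- Starting and ending points of the families of nonintersecting lattice paths that encode the
tableaux of the shape `λ/μ`: with rows counted from `1`, the lower points have abscissas `μ_i - i`
and the upper points have abscissas `λ_i - i`. -/
def points (A : SkewShape) : Finset Point :=
  (Finset.univ.image fun i => A.inner i - (i : ℤ) - 1).disjSum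
    (Finset.univ.image fun i => A.outer i - (i : ℤ) - 1)

end SkewShape

theorem antitone_shift {k : ℕ} {f : Fin k → ℤ} (hf : StrictMono f) :
    Antitone fun i : Fin k => f i.rev + (i : ℤ) + 1 := by
  have key : ∀ (d : ℕ) (i j : Fin k), (j : ℕ) = i + d → f i + d ≤ f j := by
    intro d
    induction d with
    | zero =>
      intro i j h
      have : i = j := Fin.ext (by omega)
      simp [this]
    | succ d ih =>
      intro i j h
      have h1 := ih i ⟨i + d, by omega⟩ rfl
      have h2 : f ⟨i + d, by omega⟩ < f j := hf (by rw [Fin.lt_def]; simp; omega)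
      push_cast
      omega
  intro i j hij
  have hij' : (i : ℕ) ≤ j := hij
  have := key (j - i) j.rev i.rev (by simp [Fin.val_rev]; omega)
  simp only
  omega

/-- The skew shape whose set of points is the given finite set of points, which has to contain
equally many lower and upper points: if `u_1 > u_2 > ⋯` are the abscissas of the upper points and
`l_1 > l_2 > ⋯` those of the lower points, then it is `λ/μ` with `λ_i = u_i + i`,
`μ_i = l_i + i`. -/
def shapeOfPoints (P : Finset Point) (h : P.toLeft.card = P.toRight.card) : SkewShape where
  rows := P.toRight.card
  outer i := P.toRight.orderEmbOfFin rfl i.rev + (i : ℤ) + 1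
  inner i := P.toLeft.orderEmbOfFin h i.rev + (i : ℤ) + 1
  outer_antitone := antitone_shift (P.toRight.orderEmbOfFin rfl).strictMono
  inner_antitone := antitone_shift (P.toLeft.orderEmbOfFin h).strictMono

/-! ### Coloured points and radial orientations

In an overlay the paths of the first shape are green and those of the second one are red. -/

/-- The coloured points of the configuration of points of a pair of shapes: those that belong to
exactly one of the two shapes. -/
def coloured (A B : SkewShape) : Finset Point := symmDiff A.points B.points

/-- The uncoloured points: those that belong to both shapes. -/
def uncoloured (A B : SkewShape) : Finset Point := A.points ∩ B.points

inductive Orientation where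
  | inward
  | outward
  deriving DecidableEq

instance : Fintype Orientation where
  elems := {.inward, .outward}
  complete o := by cases o <;> simp

/-- The opposite orientation. -/
def Orientation.flip : Orientation → Orientation
  | .inward => .outward
  | .outward => .inward

/-- A radial orientation of the coloured points. -/
abbrev RadialOrientation (A B : SkewShape) : Type := coloured A B → Orientation

/-- Green paths are traversed upwards and red paths downwards, so the green points are the lower
points oriented inwards and the upper points oriented outwards. -/
def IsGreen : Point → Orientation → Prop
  | .inl _, o => o = .inward
  | .inr _, o => o = .outward

instance : ∀ (p : Point) (o : Orientation), Decidable (IsGreen p o)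
  | .inl _, o => inferInstanceAs (Decidable (o = .inward))
  | .inr _, o => inferInstanceAs (Decidable (o = .outward))

/-- The radial orientation of the pair of shapes itself: the coloured points of the first shape are
green, those of the second one are red. -/
def initialOrientation (A B : SkewShape) : RadialOrientation A B := fun p =>
  match p.1 with
  | .inl x => if Sum.inl x ∈ A.points then .inward else .outward
  | .inr x => if Sum.inr x ∈ A.points then .outward else .inward

/-- The starting and ending points of green paths: all uncoloured points and all green points. -/
def greenPoints {A B : SkewShape} (r : RadialOrientation A B) : Finset Point :=
  uncoloured A B ∪
    (Finset.univ.filter fun p : coloured A B => IsGreen p.1 (r p)).map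
      (Function.Embedding.subtype _)

/-- The starting and ending points of red paths: all uncoloured points and all red points. -/
def redPoints {A B : SkewShape} (r : RadialOrientation A B) : Finset Point :=
  uncoloured A B ∪
    (Finset.univ.filter fun p : coloured A B => ¬ IsGreen p.1 (r p)).map
      (Function.Embedding.subtype _)

/-- A radial orientation is admissible if as many points are oriented inwards as outwards. -/
def Admissible {A B : SkewShape} (r : RadialOrientation A B) : Prop :=
  (Finset.univ.filter fun p => r p = .inward).card =
    (Finset.univ.filter fun p => r p = .outward).card

/-! ### An admissible orientation corresponds to a pair of skew shapes -/

/-- Sign `-1` for lower points, `+1` for upper points. -/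
def levelSign : Point → ℤ := Sum.elim (fun _ => -1) (fun _ => 1)

theorem sum_levelSign (P : Finset Point) :
    ∑ p ∈ P, levelSign p = (P.toRight.card : ℤ) - P.toLeft.card := by
  conv_lhs => rw [← Finset.toLeft_disjSum_toRight (u := P)]
  rw [Finset.sum_disjSum]
  simp [levelSign]
  ring

theorem SkewShape.sum_levelSign_points (A : SkewShape) : ∑ p ∈ A.points, levelSign p = 0 := by
  have h : ∀ f : Fin A.rows → ℤ, Antitone f →
      (Finset.univ.image fun i => f i - (i : ℤ) - 1).card = A.rows := by
    intro f hf
    rw [Finset.card_image_of_injective, Finset.card_fin]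
    intro i j hij
    simp only at hij
    rcases lt_trichotomy i j with h | h | h
    · have h1 := hf h.le
      have h2 : (i : ℕ) < j := h
      omega
    · exact h
    · have h1 := hf h.le
      have h2 : (j : ℕ) < i := h
      omega
  rw [sum_levelSign, SkewShape.points, Finset.toRight_disjSum, Finset.toLeft_disjSum,
    h _ A.outer_antitone, h _ A.inner_antitone, sub_self]

theorem sum_split {A B : SkewShape} (s : coloured A B → Prop) [DecidablePred s] (f : Point → ℤ) :
    ∑ p ∈ uncoloured A B ∪ (Finset.univ.filter s).map (Function.Embedding.subtype _), f p =
      ∑ p ∈ uncoloured A B, f p + ∑ p : coloured A B, if s p then f p.1 else 0 := by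
  rw [Finset.sum_union, Finset.sum_map, Finset.sum_filter]
  · rfl
  · rw [Finset.disjoint_left]
    intro p hp hq
    obtain ⟨q, -, rfl⟩ := Finset.mem_map.1 hq
    have hq2 := q.2
    simp only [uncoloured, Finset.mem_inter] at hp
    simp only [coloured, Finset.mem_symmDiff] at hq2
    simp only [Function.Embedding.subtype_apply] at hp
    tauto

theorem sum_uncoloured_coloured (A B : SkewShape) :
    2 * ∑ p ∈ uncoloured A B, levelSign p + ∑ p : coloured A B, levelSign p.1 = 0 := by
  have h1 := A.sum_levelSign_points
  have h2 := B.sum_levelSign_points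
  have h3 : A.points ∪ B.points = uncoloured A B ∪ coloured A B := by
    ext p
    simp only [uncoloured, coloured, Finset.mem_union, Finset.mem_inter, Finset.mem_symmDiff]
    tauto
  have h4 := Finset.sum_union_inter (s₁ := A.points) (s₂ := B.points) (f := levelSign)
  have h5 : Disjoint (uncoloured A B) (coloured A B) := by
    rw [Finset.disjoint_left]
    intro p
    simp only [uncoloured, coloured, Finset.mem_inter, Finset.mem_symmDiff]
    tauto
  rw [h3, Finset.sum_union h5] at h4
  have h6 : ∑ p : coloured A B, levelSign p.1 = ∑ p ∈ coloured A B, levelSign p :=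
    Finset.sum_coe_sort (coloured A B) levelSign
  have h7 : ∑ p ∈ A.points ∩ B.points, levelSign p = ∑ p ∈ uncoloured A B, levelSign p := rfl
  linarith

theorem Admissible.sum_eq {A B : SkewShape} {r : RadialOrientation A B} (hr : Admissible r) :
    ∑ p : coloured A B, (if IsGreen p.1 (r p) then levelSign p.1 else 0) =
      ∑ p : coloured A B, (if ¬ IsGreen p.1 (r p) then levelSign p.1 else 0) := by
  rw [← sub_eq_zero, ← Finset.sum_sub_distrib]
  have h : ∀ p : coloured A B, ((if IsGreen p.1 (r p) then levelSign p.1 else 0) -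
      (if ¬ IsGreen p.1 (r p) then levelSign p.1 else 0)) =
      (if r p = .outward then 1 else 0) - (if r p = .inward then 1 else 0) := by
    rintro ⟨p | p, hp⟩ <;> rcases h : r ⟨_, hp⟩ <;> simp [IsGreen, levelSign]
  rw [Finset.sum_congr rfl fun p _ => h p, Finset.sum_sub_distrib, Finset.sum_boole,
    Finset.sum_boole, sub_eq_zero]
  exact_mod_cast hr.symm

theorem Admissible.card_greenPoints {A B : SkewShape} {r : RadialOrientation A B}
    (hr : Admissible r) : (greenPoints r).toLeft.card = (greenPoints r).toRight.card := by
  have h1 := sum_levelSign (greenPoints r)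
  have h2 := sum_split (fun p : coloured A B => IsGreen p.1 (r p)) levelSign
  have h3 := sum_uncoloured_coloured A B
  have h4 := hr.sum_eq
  have h5 : ∑ p : coloured A B, levelSign p.1 =
      ∑ p : coloured A B, (if IsGreen p.1 (r p) then levelSign p.1 else 0) +
      ∑ p : coloured A B, (if ¬ IsGreen p.1 (r p) then levelSign p.1 else 0) := by
    rw [← Finset.sum_add_distrib]
    exact Finset.sum_congr rfl fun p _ => by split_ifs <;> simp_all
  rw [greenPoints] at h1 ⊢
  omega

theorem Admissible.card_redPoints {A B : SkewShape} {r : RadialOrientation A B}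
    (hr : Admissible r) : (redPoints r).toLeft.card = (redPoints r).toRight.card := by
  have h1 := sum_levelSign (redPoints r)
  have h2 := sum_split (fun p : coloured A B => ¬ IsGreen p.1 (r p)) levelSign
  have h3 := sum_uncoloured_coloured A B
  have h4 := hr.sum_eq
  have h5 : ∑ p : coloured A B, levelSign p.1 =
      ∑ p : coloured A B, (if IsGreen p.1 (r p) then levelSign p.1 else 0) +
      ∑ p : coloured A B, (if ¬ IsGreen p.1 (r p) then levelSign p.1 else 0) := by
    rw [← Finset.sum_add_distrib]
    exact Finset.sum_congr rfl fun p _ => by split_ifs <;> simp_all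
  rw [redPoints] at h1 ⊢
  omega

/-- The first (green) shape of the pair of skew shapes of an admissible radial orientation. -/
def greenShape {A B : SkewShape} (r : RadialOrientation A B) (hr : Admissible r) : SkewShape :=
  shapeOfPoints (greenPoints r) hr.card_greenPoints

/-- The second (red) shape of the pair of skew shapes of an admissible radial orientation. -/
def redShape {A B : SkewShape} (r : RadialOrientation A B) (hr : Admissible r) : SkewShape :=
  shapeOfPoints (redPoints r) hr.card_redPoints

/-! ### The Dodgson recolouring scheme -/

/-- `m` is a noncrossing oriented perfect matching of the coloured points for the orientation `r`:
the edges are the pairs `{p, m p}`, each edge joins points of different orientation, and no two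
edges cross when drawn inside the circle. -/
structure IsNoncrossingMatching {A B : SkewShape} (r : RadialOrientation A B)
    (m : coloured A B → coloured A B) : Prop where
  involutive : Function.Involutive m
  orientation_ne : ∀ p, r (m p) ≠ r p
  noncrossing : ∀ p q, Precedes p.1 q.1 → Precedes q.1 (m p).1 → ¬ Precedes (m p).1 (m q).1

/-- Reverse the orientation of both end points of all edges of `m` incident with a point of `S`. -/
def reverseEdges {A B : SkewShape} (S : Finset (coloured A B)) (m : coloured A B → coloured A B)
    (r : RadialOrientation A B) : RadialOrientation A B :=
  fun p => if p ∈ S ∨ m p ∈ S then (r p).flip else r p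

/-- The admissible radial orientations in which all points of `S` have the same orientation. -/
abbrev Vertex (A B : SkewShape) (S : Finset (coloured A B)) : Type :=
  {r : RadialOrientation A B // Admissible r ∧ ∃ o, ∀ p ∈ S, r p = o}

/-- The recolouring graph: two different vertices are adjacent if the Dodgson recolouring scheme
for `S` leads from one of them to the other. -/
def recolouringGraph (A B : SkewShape) (S : Finset (coloured A B)) :
    SimpleGraph (Vertex A B S) :=
  SimpleGraph.fromRel fun v w => ∃ m, IsNoncrossingMatching v.1 m ∧ w.1 = reverseEdges S m v.1

/-- The vertices in which all points of `S` have orientation `o`. -/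
def orientedClass (A B : SkewShape) (S : Finset (coloured A B)) (o : Orientation) :
    Set (Vertex A B S) :=
  {v | ∀ p ∈ S, v.1 p = o}

/-- The product of the two skew Schur functions of a vertex. -/
noncomputable def schurProduct (n : ℕ) {A B : SkewShape} {S : Finset (coloured A B)}
    (v : Vertex A B S) : MvPolynomial (Fin n) ℤ :=
  (greenShape v.1 v.2.1).schur n * (redShape v.1 v.2.1).schur n

open Classical in
/-- The sum of the products of skew Schur functions over a set of vertices. -/
noncomputable def schurSum (n : ℕ) {A B : SkewShape} {S : Finset (coloured A B)}
    (W : Set (Vertex A B S)) : MvPolynomial (Fin n) ℤ :=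
  ∑ v : Vertex A B S with v ∈ W, schurProduct n v

end DodgsonScheme

/-!
Superpose the two families of nonintersecting lattice paths of a pair of shapes. The paths that
alternate between the two families connect the coloured points by a noncrossing oriented matching,
and recolouring the ones which start in `S` preserves the weight. What this says on the level of
generating functions is that there are polynomials `f m`, one for each noncrossing perfect matching
`m` of the coloured points and independent of the orientation, such that the product of the two
Schur functions of an admissible orientation is the sum of the `f m` over all `m` compatible with
it, i.e. joining points of different orientation only. In other words, as a function of the
orientation the product lies in the span `planarSpan` of the compatibility functions of noncrossing
matchings. Granted this, the identity has to be checked for a single compatibility function only,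
where it is the bijection `v ↦ reverseEdges S m v` between the compatible orientations of the two
classes (`sum_compatible_eq`); this bijection moves every vertex along an edge of the graph and so
stays in the connected component.

The membership in `planarSpan` is proved by growing the tableaux box by box, which replaces the
planarity of the superposed paths by local moves. Order the boxes of a tableau by their entry and,
for equal entries, by their content. The last box is then a corner, and in terms of the points of
the shape adding it to a smaller shape moves an upper point from abscissa `p` to the free place
`p + 1`. Therefore admitting one more pair of an entry `k` and a content `p`, larger than the
previous ones, changes the generating function by the operation `hop` with weight `X k`
(`pointSchur_insert`). Initially no boxes are admitted, the generating function is `1` if the upper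
and the lower points agree and `0` otherwise, and the product of two such functions is the
compatibility function of a family of nested chords (`isPlanarPairing_diagonal`). A hop applied to
both factors only affects the two neighbouring places `p` and `p + 1` and is a combination of the
operations of planar diagrams there: moving the end of a chord (`shift_mem`), inserting a chord
between neighbours (`cup_mem`), and contracting two neighbours (`cap_mem`), in which case two chords
are joined or a loop is closed. All of these preserve noncrossing matchings
(`IsPlanarPairing.hop`).
-/

namespace DodgsonScheme

/-! ### Noncrossing matchings as tensors

The option `-Sum` of `grind` keeps it from splitting points into lower and upper ones. -/

theorem Precedes.asymm {p q : Point} (h : Precedes p q) : ¬ Precedes q p := by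
  rcases p with p | p <;> rcases q with q | q <;> simp_all [Precedes]
  all_goals omega

theorem Precedes.trans {p q s : Point} (h : Precedes p q) (h' : Precedes q s) :
    Precedes p s := by
  rcases p with p | p <;> rcases q with q | q <;> rcases s with s | s <;>
    simp_all [Precedes]
  all_goals omega

theorem precedes_or {p q : Point} (h : p ≠ q) : Precedes p q ∨ Precedes q p := by
  rcases p with p | p <;> rcases q with q | q <;> simp_all [Precedes]
  all_goals omega

theorem not_precedes_iff {p q : Point} (h : p ≠ q) : ¬ Precedes p q ↔ Precedes q p :=
  ⟨(precedes_or h).resolve_left, fun h' => h'.asymm⟩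

/-- The chord joining `p` and `p'` separates `x` from the base point of the circle: exactly one of
its end points precedes `x`. -/
def Encloses (p p' x : Point) : Prop := ¬ (Precedes p x ↔ Precedes p' x)

/-- The parity of the number of pairs in relation is symmetric in the two chords, so that it does
not matter which of two chords is tested against the end points of the other. -/
theorem encloses_iff_encloses_symm {p p' q q' : Point} (h1 : p ≠ q) (h2 : p ≠ q') (h3 : p' ≠ q)
    (h4 : p' ≠ q') :
    (Encloses p p' q ↔ Encloses p p' q') ↔ (Encloses q q' p ↔ Encloses q q' p') := by
  unfold Encloses
  rw [← not_precedes_iff h1, ← not_precedes_iff h2, ← not_precedes_iff h3, ← not_precedes_iff h4]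
  tauto

/-- The function `m` restricts to a perfect matching of `C` by pairwise noncrossing chords; its
values outside `C` are irrelevant. Chords do not cross if each of them encloses both or none of the
end points of the other. -/
structure IsPlanarMatching (C : Finset Point) (m : Point → Point) : Prop where
  mem : ∀ p ∈ C, m p ∈ C
  invol : ∀ p ∈ C, m (m p) = p
  ne : ∀ p ∈ C, m p ≠ p
  planar : ∀ p ∈ C, ∀ q ∈ C, q ≠ p → q ≠ m p →
    (Encloses p (m p) q ↔ Encloses p (m p) (m q))

/-- No point lies between `a` and `b` on the circle. -/
def Adjacent (a b : Point) : Prop :=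
  ∀ x, x ≠ a → x ≠ b → ((Precedes a x ↔ Precedes b x) ∧ (Precedes x a ↔ Precedes x b))

theorem Adjacent.symm {a b : Point} (h : Adjacent a b) : Adjacent b a := fun x hb ha =>
  ⟨(h x ha hb).1.symm, (h x ha hb).2.symm⟩

theorem adjacent_inr (x : ℤ) : Adjacent (Sum.inr x) (Sum.inr (x + 1)) := by
  rintro (y | y) h1 h2 <;> simp_all [Precedes]
  omega

variable {R : Type*} [CommRing R]

open Classical in
/-- The function of the orientation which is `1` if all edges of the matching `m` of `C` join points
of different orientation and `0` otherwise. -/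
noncomputable def compatible (R : Type*) [CommRing R] (C : Finset Point) (m : Point → Point)
    (o : Point → Orientation) : R :=
  if ∀ p ∈ C, o (m p) ≠ o p then 1 else 0

/-- The span of the compatibility functions of the noncrossing perfect matchings of `C`. Up to
signs this is the space of `SL₂`-invariant tensors with one factor for each point of `C`. -/
def planarSpan (R : Type*) [CommRing R] (C : Finset Point) :
    Submodule R ((Point → Orientation) → R) :=
  Submodule.span R {φ | ∃ m, IsPlanarMatching C m ∧ φ = compatible R C m}

theorem compatible_mem {C : Finset Point} {m : Point → Point} (h : IsPlanarMatching C m) :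
    compatible R C m ∈ planarSpan R C :=
  Submodule.subset_span ⟨m, h, rfl⟩

/-- A linear operation which maps the compatibility functions of noncrossing matchings of `C` into
`planarSpan R C'` maps all of `planarSpan R C` there. -/
theorem map_planarSpan {C C' : Finset Point}
    (T : ((Point → Orientation) → R) →ₗ[R] ((Point → Orientation) → R))
    (h : ∀ m, IsPlanarMatching C m → T (compatible R C m) ∈ planarSpan R C')
    {φ : (Point → Orientation) → R} (hφ : φ ∈ planarSpan R C) : T φ ∈ planarSpan R C' := by
  have : planarSpan R C ≤ (planarSpan R C').comap T := by
    refine Submodule.span_le.2 ?_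
    rintro _ ⟨m, hm, rfl⟩
    exact h m hm
  exact this hφ

/-- Inserting a chord between adjacent points. -/
theorem IsPlanarMatching.cup {C : Finset Point} {m : Point → Point} (hm : IsPlanarMatching C m)
    {a b : Point} (hab : Adjacent a b) (hne : a ≠ b) (ha : a ∉ C) (hb : b ∉ C) :
    IsPlanarMatching (insert a (insert b C))
      (fun p => if p = a then b else if p = b then a else m p) := by
  have hmem := hm.mem
  have hinv := hm.invol
  have hn := hm.ne
  generalize hm' : (fun p => if p = a then b else if p = b then a else m p) = m'
  have ea : m' a = b := by simp [← hm']
  have eb : m' b = a := by simp [← hm', hne.symm]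
  have eC : ∀ p ∈ C, m' p = m p := by
    intro p hp
    have h1 : p ≠ a := fun h => ha (h ▸ hp)
    have h2 : p ≠ b := fun h => hb (h ▸ hp)
    simp [← hm', h1, h2]
  clear hm'
  have hna : ∀ p ∈ C, p ≠ a := fun p hp h => ha (h ▸ hp)
  have hnb : ∀ p ∈ C, p ≠ b := fun p hp h => hb (h ▸ hp)
  have hE : ∀ p ∈ C, ¬ Encloses a b p ∧ ¬ Encloses b a p := fun p hp => by
    have := hab p (hna p hp) (hnb p hp)
    unfold Encloses
    tauto
  have hE' : ∀ p ∈ C, (Encloses p (m p) a ↔ Encloses p (m p) b) := fun p hp => by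
    have h1 := hab p (hna p hp) (hnb p hp)
    have h2 := hab (m p) (hna _ (hmem p hp)) (hnb _ (hmem p hp))
    unfold Encloses
    rw [h1.2, h2.2]
  refine ⟨?_, ?_, ?_, ?_⟩
  · intro p hp
    simp only [Finset.mem_insert] at hp ⊢
    rcases hp with rfl | rfl | hp
    · simp [ea]
    · simp [eb]
    · simp [eC p hp, hmem p hp]
  · intro p hp
    simp only [Finset.mem_insert] at hp
    rcases hp with rfl | rfl | hp
    · rw [ea, eb]
    · rw [eb, ea]
    · rw [eC p hp, eC _ (hmem p hp), hinv p hp]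
  · intro p hp
    simp only [Finset.mem_insert] at hp
    rcases hp with rfl | rfl | hp
    · rw [ea]; exact hne.symm
    · rw [eb]; exact hne
    · rw [eC p hp]; exact hn p hp
  · intro p hp q hq h1 h2
    simp only [Finset.mem_insert] at hp hq
    rcases hp with rfl | rfl | hp
    · rw [ea] at h2 ⊢
      have hq' : q ∈ C := by tauto
      rw [eC q hq']
      exact iff_of_false (hE q hq').1 (hE _ (hmem q hq')).1
    · rw [eb] at h2 ⊢
      have hq' : q ∈ C := by tauto
      rw [eC q hq']
      exact iff_of_false (hE q hq').2 (hE _ (hmem q hq')).2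
    · rw [eC p hp] at h2 ⊢
      rcases hq with rfl | rfl | hq
      · rw [ea]; exact hE' p hp
      · rw [eb]; exact (hE' p hp).symm
      · rw [eC q hq]; exact hm.planar p hp q hq h1 h2

/-- Removing adjacent points and joining their partners. -/
theorem IsPlanarMatching.cap_join {C : Finset Point} {m : Point → Point} {a b : Point}
    (hm : IsPlanarMatching (insert a (insert b C)) m)
    (hab : Adjacent a b) (hne : a ≠ b) (ha : a ∉ C) (hb : b ∉ C) (hmab : m a ≠ b) :
    IsPlanarMatching C
      (fun p => if p = m a then m b else if p = m b then m a else m p) := by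
  have hmem := hm.mem
  have hinv := hm.invol
  have hn := hm.ne
  have hpl := hm.planar
  have ha' : m a ∈ C := by grind [-Sum]
  have hb' : m b ∈ C := by grind [-Sum]
  have hne' : m a ≠ m b := by grind [-Sum]
  have hC : ∀ p ∈ C, p ≠ m a → p ≠ m b → m p ∈ C ∧ m p ≠ m a ∧ m p ≠ m b := by
    intro p hp h1 h2
    have := hinv p (by simp [hp])
    have := hinv a (by simp)
    have := hinv b (by simp)
    have := hmem p (by simp [hp])
    grind [-Sum]
  -- a chord away from `a` and `b` encloses both or none of their partners
  have key : ∀ p ∈ C, p ≠ m a → p ≠ m b →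
      (Encloses p (m p) (m a) ↔ Encloses p (m p) (m b)) := by
    intro p hp h1 h2
    have e1 := hpl p (by grind [-Sum]) a (by grind [-Sum]) (by grind [-Sum]) (by grind [-Sum])
    have e2 := hpl p (by grind [-Sum]) b (by grind [-Sum]) (by grind [-Sum]) (by grind [-Sum])
    rw [← e1, ← e2]
    have A := hab p (by grind [-Sum]) (by grind [-Sum])
    have A' := hab (m p) (by grind [-Sum]) (by grind [-Sum])
    unfold Encloses
    rw [A.2, A'.2]
  have key' : ∀ p ∈ C, p ≠ m a → p ≠ m b →
      (Encloses (m a) (m b) p ↔ Encloses (m a) (m b) (m p)) := by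
    intro p hp h1 h2
    rw [encloses_iff_encloses_symm (by grind [-Sum]) (by grind [-Sum]) (by grind [-Sum])
      (by grind [-Sum])]
    exact key p hp h1 h2
  have comm : ∀ x y z, Encloses x y z ↔ Encloses y x z := by
    intro x y z
    unfold Encloses
    tauto
  have hmm : ∀ p ∈ C, m (m p) = p := fun p hp => hinv p (by simp [hp])
  have hpp : ∀ p ∈ C, m p ≠ p := fun p hp => hn p (by simp [hp])
  refine ⟨?_, ?_, ?_, ?_⟩
  · intro p hp
    split_ifs with h1 h2
    exacts [hb', ha', (hC p hp h1 h2).1]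
  · intro p hp
    by_cases h1 : p = m a
    · simp [h1, hne'.symm]
    by_cases h2 : p = m b
    · simp [h2]
    simp [h1, h2, hC p hp h1 h2, hmm p hp]
  · intro p hp
    by_cases h1 : p = m a
    · simp [h1, hne'.symm]
    by_cases h2 : p = m b
    · simp [h2, hne', hne'.symm]
    simp [h1, h2, hpp p hp]
  · intro p hp q hq h1 h2
    by_cases p1 : p = m a
    · subst p1
      have := key' q hq
      grind [-Sum]
    by_cases p2 : p = m b
    · subst p2
      have := key' q hq
      have := comm (m b) (m a)
      grind [-Sum]
    have := key p hp p1 p2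
    have := hpl p (by grind [-Sum]) q (by grind [-Sum]) h1
    grind [-Sum]

theorem IsPlanarMatching.cap_loop {C : Finset Point} {m : Point → Point} {a b : Point}
    (hm : IsPlanarMatching (insert a (insert b C)) m) (ha : a ∉ C) (hb : b ∉ C)
    (hmab : m a = b) : IsPlanarMatching C m := by
  have hmem := hm.mem
  have hinv := hm.invol
  refine ⟨?_, ?_, ?_, ?_⟩
  · intro p hp
    grind [-Sum]
  · exact fun p hp => hm.invol p (by simp [hp])
  · exact fun p hp => hm.ne p (by simp [hp])
  · exact fun p hp q hq => hm.planar p (by simp [hp]) q (by simp [hq])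

/-- Moving a point to an adjacent free place. -/
theorem IsPlanarMatching.shift {C : Finset Point} {m : Point → Point} {a b : Point}
    (hm : IsPlanarMatching (insert a C) m)
    (hab : Adjacent a b) (ha : a ∉ C) (hb : b ∉ C) :
    IsPlanarMatching (insert b C) (Equiv.swap a b ∘ m ∘ Equiv.swap a b) := by
  set s := Equiv.swap a b with hs
  have hmap : ∀ p, p ∈ insert b C ↔ s p ∈ insert a C := by
    intro p
    rw [hs, Equiv.swap_apply_def]
    grind [-Sum]
  have hss : ∀ p, s (s p) = p := fun p => by simp [s]
  -- only one of `a` and `b` occurs on either side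
  have hprec : ∀ p ∈ insert a C, ∀ q ∈ insert a C, (Precedes (s p) (s q) ↔ Precedes p q) := by
    intro p hp q hq
    have irr : ∀ x, ¬ Precedes x x := fun x h => h.asymm h
    have A := hab p
    have B := hab q
    have C1 := irr a
    have C2 := irr b
    rw [hs, Equiv.swap_apply_def, Equiv.swap_apply_def]
    grind [-Sum]
  refine ⟨?_, ?_, ?_, ?_⟩
  · intro p hp
    rw [hmap] at hp ⊢
    simpa [hss] using hm.mem _ hp
  · intro p hp
    rw [hmap] at hp
    simp [hss, hm.invol _ hp]
  · intro p hp h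
    rw [hmap] at hp
    refine hm.ne _ hp ?_
    rw [← hss (m (s p))]
    exact congrArg s h
  · intro p hp q hq h1 h2
    rw [hmap] at hp hq
    have h := hm.planar _ hp _ hq (fun h => h1 (s.injective h))
      (fun h => h2 (by rw [← hss q, h]; rfl))
    simp only [Encloses, Function.comp] at h ⊢
    have e1 := hprec _ hp _ hq
    have e2 := hprec _ hp _ (hm.mem _ hq)
    have e3 := hprec _ (hm.mem _ hp) _ hq
    have e4 := hprec _ (hm.mem _ hp) _ (hm.mem _ hq)
    simp only [hss] at e1 e2 e3 e4
    rw [e1, e2, e3, e4]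
    exact h

open Classical in
/-- Tensoring with the chord joining two adjacent places. -/
theorem cup_mem {C : Finset Point} {a b : Point} (hab : Adjacent a b) (hne : a ≠ b) (ha : a ∉ C)
    (hb : b ∉ C) {φ : (Point → Orientation) → R} (hφ : φ ∈ planarSpan R C) :
    (fun o => if o a ≠ o b then φ o else 0) ∈ planarSpan R (insert a (insert b C)) := by
  let T : ((Point → Orientation) → R) →ₗ[R] ((Point → Orientation) → R) :=
    { toFun := fun φ o => if o a ≠ o b then φ o else 0
      map_add' := by intro f g; ext o; simp only [Pi.add_apply]; split_ifs <;> simp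
      map_smul' := by intro r f; ext o; simp }
  refine map_planarSpan T (fun m hm => ?_) hφ
  convert compatible_mem (hm.cup hab hne ha hb) using 1
  funext o
  change (if o a ≠ o b then compatible R C m o else 0) = _
  unfold compatible
  rw [← ite_and]
  refine if_congr ?_ rfl rfl
  constructor
  · rintro ⟨h1, h2⟩ p hp
    have := h2 p
    grind [-Sum]
  · intro h
    refine ⟨?_, fun p hp => ?_⟩
    · have := h a (by simp)
      grind [-Sum]
    · have := h p (by simp [hp])
      grind [-Sum]

/-- Contracting two adjacent places: either their partners are joined, or a loop is closed, which
contributes a factor `2`. -/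
theorem cap_mem {C : Finset Point} {a b : Point} (hab : Adjacent a b) (hne : a ≠ b) (ha : a ∉ C)
    (hb : b ∉ C) {φ : (Point → Orientation) → R}
    (hφ : φ ∈ planarSpan R (insert a (insert b C))) :
    (fun o => φ (Function.update (Function.update o a .outward) b .inward) +
      φ (Function.update (Function.update o a .inward) b .outward)) ∈ planarSpan R C := by
  let T : ((Point → Orientation) → R) →ₗ[R] ((Point → Orientation) → R) :=
    { toFun := fun φ o => φ (Function.update (Function.update o a .outward) b .inward) +
        φ (Function.update (Function.update o a .inward) b .outward)
      map_add' := by intro f g; ext o; simp only [Pi.add_apply]; ring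
      map_smul' := by intro r f; ext o; simp [mul_add] }
  refine map_planarSpan T (fun m hm => ?_) hφ
  have hmem := hm.mem
  have hinv := hm.invol
  have hn := hm.ne
  by_cases hmab : m a = b
  · -- the removed chord closes up to a loop with two orientations
    convert (planarSpan R C).smul_mem (2 : R) (compatible_mem (hm.cap_loop ha hb hmab)) using 1
    funext o
    change compatible R _ m _ + compatible R _ m _ = 2 * compatible R C m o
    have key : ∀ x y : Orientation, x ≠ y → compatible R (insert a (insert b C)) m
        (Function.update (Function.update o a x) b y) = compatible R C m o := by
      intro x y hxy
      unfold compatible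
      refine if_congr ?_ rfl rfl
      simp only [Function.update_apply]
      constructor
      · intro h p hp
        have := h p (by simp [hp])
        grind [-Sum]
      · intro h p hp
        have := h p
        grind [-Sum]
    rw [key _ _ (by simp), key _ _ (by simp)]
    ring
  · convert compatible_mem (hm.cap_join hab hne ha hb hmab) using 1
    funext o
    change compatible R _ m _ + compatible R _ m _ = _
    have ha' : m a ∈ C := by grind [-Sum]
    have hb' : m b ∈ C := by grind [-Sum]
    have hne' : m a ≠ m b := by grind [-Sum]
    have key : ∀ x y : Orientation, (∀ p ∈ insert a (insert b C),
        Function.update (Function.update o a x) b y (m p) ≠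
          Function.update (Function.update o a x) b y p) ↔
        (o (m a) ≠ x ∧ o (m b) ≠ y ∧ ∀ p ∈ C, p ≠ m a → p ≠ m b → o (m p) ≠ o p) := by
      intro x y
      simp only [Function.update_apply]
      constructor
      · intro h
        have h1 := h a (by simp)
        have h2 := h b (by simp)
        refine ⟨by grind, by grind, fun p hp h3 h4 => ?_⟩
        have := h p (by simp [hp])
        grind [-Sum]
      · rintro ⟨h1, h2, h3⟩ p hp
        have := h3 p
        by_cases p1 : p = m a
        · grind [-Sum]
        by_cases p2 : p = m b
        · grind [-Sum]
        grind [-Sum]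
    have key' : (∀ p ∈ C, o (if p = m a then m b else if p = m b then m a else m p) ≠ o p) ↔
        (o (m a) ≠ o (m b) ∧ ∀ p ∈ C, p ≠ m a → p ≠ m b → o (m p) ≠ o p) := by
      constructor
      · intro h
        have h1 := h _ ha'
        refine ⟨by grind, fun p hp h3 h4 => ?_⟩
        have := h p hp
        grind [-Sum]
      · rintro ⟨h1, h3⟩ p hp
        have := h3 p hp
        grind [-Sum]
    unfold compatible
    simp only [key, key']
    rcases o (m a) <;> rcases o (m b) <;> simp
    all_goals exact if_congr (by simp) rfl rfl

theorem shift_mem {C : Finset Point} {a b : Point} (hab : Adjacent a b) (ha : a ∉ C)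
    (hb : b ∉ C) {φ : (Point → Orientation) → R} (hφ : φ ∈ planarSpan R (insert a C)) :
    (fun o => φ (o ∘ Equiv.swap a b)) ∈ planarSpan R (insert b C) := by
  let T : ((Point → Orientation) → R) →ₗ[R] ((Point → Orientation) → R) :=
    { toFun := fun φ o => φ (o ∘ Equiv.swap a b)
      map_add' := by intro f g; rfl
      map_smul' := by intro r f; rfl }
  refine map_planarSpan T (fun m hm => ?_) hφ
  convert compatible_mem (hm.shift hab ha hb) using 1
  funext o
  change compatible R _ m (o ∘ Equiv.swap a b) = _
  unfold compatible
  refine if_congr ?_ rfl rfl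
  have hmap : ∀ p, p ∈ insert b C ↔ Equiv.swap a b p ∈ insert a C := by
    intro p
    rw [Equiv.swap_apply_def]
    grind [-Sum]
  constructor
  · intro h p hp
    rw [hmap] at hp
    simpa using h _ hp
  · intro h p hp
    have := h (Equiv.swap a b p) (by rw [hmap]; simpa using hp)
    simpa using this

/-! ### Hopping of upper points -/

/-- The points of the first shape if `D` is the set of uncoloured points and `C` the set of
coloured points, oriented according to `o`. -/
def greenSide (D C : Finset Point) (o : Point → Orientation) : Finset Point :=
  D ∪ C.filter fun p => IsGreen p (o p)

/-- The points of the second shape if `D` is the set of uncoloured points and `C` the set of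
coloured points, oriented according to `o`. -/
def redSide (D C : Finset Point) (o : Point → Orientation) : Finset Point :=
  D ∪ C.filter fun p => ¬ IsGreen p (o p)

theorem mem_greenSide {D C : Finset Point} {o : Point → Orientation} {x : Point} :
    x ∈ greenSide D C o ↔ x ∈ D ∨ x ∈ C ∧ IsGreen x (o x) := by
  simp [greenSide]

theorem mem_redSide {D C : Finset Point} {o : Point → Orientation} {x : Point} :
    x ∈ redSide D C o ↔ x ∈ D ∨ x ∈ C ∧ ¬ IsGreen x (o x) := by
  simp [redSide]

theorem isGreen_inr {x : ℤ} {o : Orientation} : IsGreen (Sum.inr x) o ↔ o = .outward := Iff.rfl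

/-- For fixed uncoloured and coloured points, the value of `F` at the two shapes is, as a function
of the orientation, in the span of the compatibility functions of noncrossing matchings. -/
def IsPlanarPairing (F : Finset Point → Finset Point → R) : Prop :=
  ∀ D C : Finset Point, Disjoint D C →
    (fun o => F (greenSide D C o) (redSide D C o)) ∈ planarSpan R C

/-- Replace `b` by `a`. -/
def moveTo (a b : Point) (P : Finset Point) : Finset Point := insert a (P.erase b)

theorem mem_moveTo {a b x : Point} {P : Finset Point} :
    x ∈ moveTo a b P ↔ x = a ∨ x ≠ b ∧ x ∈ P := by
  simp [moveTo]

/-- The transposed action on functions of point sets of the elementary matrix which lets the upper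
point with abscissa `p` hop to the free place `p + 1`, with weight `x`. -/
def hop (x : R) (p : ℤ) (g : Finset Point → R) (P : Finset Point) : R :=
  g P + if .inr (p + 1) ∈ P ∧ .inr p ∉ P then x * g (moveTo (.inr p) (.inr (p + 1)) P) else 0

/-- On functions of the orientation, a hop of exactly one of the two shapes acts by a shift if one of
the places `p` and `p + 1` is coloured, by a cup if both are, and by a cap if `p` is free and `p + 1`
uncoloured; a simultaneous hop of both shapes moves an uncoloured point and does not change the
coloured ones. All these operations preserve spans of noncrossing matchings. -/
theorem IsPlanarPairing.hop {g : Finset Point → R}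
    (hg : IsPlanarPairing fun P Q => g P * g Q) (x : R) (p : ℤ) :
    IsPlanarPairing fun P Q => hop x p g P * hop x p g Q := by
  intro D C hDC
  set a : Point := .inr p with ha
  set b : Point := .inr (p + 1) with hb
  have hne : a ≠ b := by simp [ha, hb]
  have hab : Adjacent a b := adjacent_inr p
  have ga : ∀ o, IsGreen a o ↔ o = .outward := fun o => isGreen_inr
  have gb : ∀ o, IsGreen b o ↔ o = .outward := fun o => isGreen_inr
  have hdis : ∀ y, y ∈ D → y ∉ C := fun y h => Finset.disjoint_left.1 hDC h
  have hF := hg D C hDC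
  have hopdef : ∀ P, DodgsonScheme.hop x p g P =
      g P + if b ∈ P ∧ a ∉ P then x * g (moveTo a b P) else 0 := fun P => rfl
  simp only [hopdef]
  clear_value a b
  have swapx : ∀ (o : Point → Orientation) (y : Point), y ≠ a → y ≠ b →
      (o ∘ Equiv.swap a b) y = o y := fun o y h1 h2 => by
    simp [Equiv.swap_apply_of_ne_of_ne h1 h2]
  have swapa : ∀ (o : Point → Orientation), (o ∘ Equiv.swap a b) a = o b := fun o => by simp
  have swapb : ∀ (o : Point → Orientation), (o ∘ Equiv.swap a b) b = o a := fun o => by simp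
  have out : ∀ y : Orientation, y ≠ .outward ↔ y = .inward := by
    intro y; cases y <;> simp
  by_cases haD : a ∈ D
  · convert hF using 2 with o
    rw [if_neg, if_neg, add_zero, add_zero]
    · simp [mem_redSide, haD]
    · simp [mem_greenSide, haD]
  by_cases hbD : b ∈ D
  · have hbC := hdis b hbD
    by_cases haC : a ∈ C
    · -- the coloured point moves in the opposite direction
      have hs := hg (moveTo a b D) (insert b (C.erase a)) (by
        rw [Finset.disjoint_left]; intro y
        have := hdis y
        simp only [mem_moveTo, Finset.mem_insert, Finset.mem_erase]
        grind [-Sum])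
      have hs' := shift_mem hab.symm (by simp [hbC]) (by simp) hs
      rw [Finset.insert_erase haC, Equiv.swap_comm] at hs'
      convert (planarSpan R C).add_mem hF ((planarSpan R C).smul_mem x hs') using 1
      funext o
      simp only [Pi.add_apply, Pi.smul_apply, smul_eq_mul]
      have m1 : b ∈ greenSide D C o ∧ b ∈ redSide D C o := by simp [mem_greenSide, mem_redSide, hbD]
      by_cases hoa : o a = .outward
      · have m2 : a ∈ greenSide D C o ∧ a ∉ redSide D C o := by
          simp [mem_greenSide, mem_redSide, haD, haC, ga, hoa]
        have e1 : greenSide (moveTo a b D) (insert b (C.erase a)) (o ∘ Equiv.swap a b) =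
            greenSide D C o := by
          ext y
          have := swapx o y
          have := swapb o
          simp only [mem_greenSide, mem_moveTo, Finset.mem_insert, Finset.mem_erase]
          grind [-Sum]
        have e2 : redSide (moveTo a b D) (insert b (C.erase a)) (o ∘ Equiv.swap a b) =
            moveTo a b (redSide D C o) := by
          ext y
          have := swapx o y
          have := swapb o
          simp only [mem_redSide, mem_moveTo, Finset.mem_insert, Finset.mem_erase]
          grind [-Sum]
        rw [e1, e2, if_neg (by tauto), if_pos (by tauto)]
        ring
      · have m2 : a ∉ greenSide D C o ∧ a ∈ redSide D C o := by
          simp [mem_greenSide, mem_redSide, haD, haC, ga, hoa]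
        have e1 : greenSide (moveTo a b D) (insert b (C.erase a)) (o ∘ Equiv.swap a b) =
            moveTo a b (greenSide D C o) := by
          ext y
          have := swapx o y
          have := swapb o
          simp only [mem_greenSide, mem_moveTo, Finset.mem_insert, Finset.mem_erase]
          grind [-Sum]
        have e2 : redSide (moveTo a b D) (insert b (C.erase a)) (o ∘ Equiv.swap a b) =
            redSide D C o := by
          ext y
          have := swapx o y
          have := swapb o
          simp only [mem_redSide, mem_moveTo, Finset.mem_insert, Finset.mem_erase]
          grind [-Sum]
        rw [e1, e2, if_pos (by tauto), if_neg (by tauto)]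
        ring
    · -- either or both of the paths through `b` may come from `a`
      have hs := cap_mem hab hne haC hbC (hg (D.erase b) (insert a (insert b C)) (by
        rw [Finset.disjoint_left]; intro y
        have := hdis y
        simp only [Finset.mem_insert, Finset.mem_erase]
        grind [-Sum]))
      have hd := hg (moveTo a b D) C (by
        rw [Finset.disjoint_left]; intro y
        have := hdis y
        simp only [mem_moveTo]
        grind [-Sum])
      convert (planarSpan R C).add_mem ((planarSpan R C).add_mem hF
        ((planarSpan R C).smul_mem x hs)) ((planarSpan R C).smul_mem (x ^ 2) hd) using 1
      funext o
      simp only [Pi.add_apply, Pi.smul_apply, smul_eq_mul]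
      have m1 : b ∈ greenSide D C o ∧ b ∈ redSide D C o := by simp [mem_greenSide, mem_redSide, hbD]
      have m2 : a ∉ greenSide D C o ∧ a ∉ redSide D C o := by
        simp [mem_greenSide, mem_redSide, haD, haC]
      have e1 : greenSide (D.erase b) (insert a (insert b C))
          (Function.update (Function.update o a .outward) b .inward) =
            moveTo a b (greenSide D C o) := by
        ext y
        simp only [mem_greenSide, mem_moveTo, Finset.mem_insert, Finset.mem_erase,
          Function.update_apply]
        grind [-Sum]
      have e2 : redSide (D.erase b) (insert a (insert b C))
          (Function.update (Function.update o a .outward) b .inward) = redSide D C o := by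
        ext y
        simp only [mem_redSide, Finset.mem_insert, Finset.mem_erase,
          Function.update_apply]
        grind [-Sum]
      have e3 : greenSide (D.erase b) (insert a (insert b C))
          (Function.update (Function.update o a .inward) b .outward) = greenSide D C o := by
        ext y
        simp only [mem_greenSide, Finset.mem_insert, Finset.mem_erase,
          Function.update_apply]
        grind [-Sum]
      have e4 : redSide (D.erase b) (insert a (insert b C))
          (Function.update (Function.update o a .inward) b .outward) =
            moveTo a b (redSide D C o) := by
        ext y
        simp only [mem_redSide, mem_moveTo, Finset.mem_insert, Finset.mem_erase,
          Function.update_apply]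
        grind [-Sum]
      have e5 : greenSide (moveTo a b D) C o = moveTo a b (greenSide D C o) := by
        ext y
        simp only [mem_greenSide, mem_moveTo]
        grind [-Sum]
      have e6 : redSide (moveTo a b D) C o = moveTo a b (redSide D C o) := by
        ext y
        simp only [mem_redSide, mem_moveTo]
        grind [-Sum]
      rw [e1, e2, e3, e4, e5, e6, if_pos (by tauto), if_pos (by tauto)]
      ring
  by_cases hbC : b ∈ C
  · by_cases haC : a ∈ C
    · -- a point hops if and only if `a` and `b` have different colours
      have hs := cup_mem hab hne (C := (C.erase a).erase b) (by simp) (by simp)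
        (hg (insert a D) ((C.erase a).erase b) (by
          rw [Finset.disjoint_left]; intro y
          have := hdis y
          simp only [Finset.mem_insert, Finset.mem_erase]
          grind [-Sum]))
      rw [Finset.insert_erase (by simp [hbC, hne.symm]), Finset.insert_erase haC] at hs
      convert (planarSpan R C).add_mem hF ((planarSpan R C).smul_mem x hs) using 1
      funext o
      simp only [Pi.add_apply, Pi.smul_apply, smul_eq_mul]
      by_cases hoa : o a = .outward <;> by_cases hob : o b = .outward
      · have m : a ∈ greenSide D C o ∧ b ∉ redSide D C o := by
          simp [mem_greenSide, mem_redSide, hbD, haC, ga, gb, hoa, hob]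
        rw [if_neg (by tauto), if_neg (by tauto), if_neg (by simp [hoa, hob])]
        ring
      · have m : a ∈ greenSide D C o ∧ b ∈ redSide D C o ∧ a ∉ redSide D C o := by
          simp [mem_greenSide, mem_redSide, haD, haC, hbC, ga, gb, hoa, hob]
        have e1 : greenSide (insert a D) ((C.erase a).erase b) o = greenSide D C o := by
          ext y
          simp only [mem_greenSide, Finset.mem_insert, Finset.mem_erase]
          grind [-Sum]
        have e2 : redSide (insert a D) ((C.erase a).erase b) o = moveTo a b (redSide D C o) := by
          ext y
          simp only [mem_redSide, mem_moveTo, Finset.mem_insert, Finset.mem_erase]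
          grind [-Sum]
        rw [e1, e2, if_neg (by tauto), if_pos (by tauto), if_pos (by grind [-Sum])]
        ring
      · have m : b ∈ greenSide D C o ∧ a ∉ greenSide D C o ∧ a ∈ redSide D C o := by
          simp [mem_greenSide, mem_redSide, haD, haC, hbC, ga, gb, hoa, hob]
        have e1 : greenSide (insert a D) ((C.erase a).erase b) o =
            moveTo a b (greenSide D C o) := by
          ext y
          simp only [mem_greenSide, mem_moveTo, Finset.mem_insert, Finset.mem_erase]
          grind [-Sum]
        have e2 : redSide (insert a D) ((C.erase a).erase b) o = redSide D C o := by
          ext y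
          simp only [mem_redSide, Finset.mem_insert, Finset.mem_erase]
          grind [-Sum]
        rw [e1, e2, if_pos (by tauto), if_neg (by tauto), if_pos (by grind [-Sum])]
        ring
      · have m : b ∉ greenSide D C o ∧ a ∈ redSide D C o := by
          simp [mem_greenSide, mem_redSide, hbD, haC, ga, gb, hoa, hob]
        rw [if_neg (by tauto), if_neg (by tauto),
          if_neg (by rw [(out _).1 hoa, (out _).1 hob]; simp)]
        ring
    · have hs := hg D (insert a (C.erase b)) (by
        rw [Finset.disjoint_left]; intro y
        have := hdis y
        simp only [Finset.mem_insert, Finset.mem_erase]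
        grind [-Sum])
      have hs' := shift_mem hab (by simp [haC]) (by simp) hs
      rw [Finset.insert_erase hbC] at hs'
      convert (planarSpan R C).add_mem hF ((planarSpan R C).smul_mem x hs') using 1
      funext o
      simp only [Pi.add_apply, Pi.smul_apply, smul_eq_mul]
      have m1 : a ∉ greenSide D C o ∧ a ∉ redSide D C o := by
        simp [mem_greenSide, mem_redSide, haD, haC]
      by_cases hob : o b = .outward
      · have m2 : b ∈ greenSide D C o ∧ b ∉ redSide D C o := by
          simp [mem_greenSide, mem_redSide, hbD, hbC, gb, hob]
        have e1 : greenSide D (insert a (C.erase b)) (o ∘ Equiv.swap a b) =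
            moveTo a b (greenSide D C o) := by
          ext y
          have := swapx o y
          have := swapa o
          simp only [mem_greenSide, mem_moveTo, Finset.mem_insert, Finset.mem_erase]
          grind [-Sum]
        have e2 : redSide D (insert a (C.erase b)) (o ∘ Equiv.swap a b) = redSide D C o := by
          ext y
          have := swapx o y
          have := swapa o
          simp only [mem_redSide, Finset.mem_insert, Finset.mem_erase]
          grind [-Sum]
        rw [e1, e2, if_pos (by tauto), if_neg (by tauto)]
        ring
      · have m2 : b ∉ greenSide D C o ∧ b ∈ redSide D C o := by
          simp [mem_greenSide, mem_redSide, hbD, hbC, gb, hob]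
        have e1 : greenSide D (insert a (C.erase b)) (o ∘ Equiv.swap a b) = greenSide D C o := by
          ext y
          have := swapx o y
          have := swapa o
          simp only [mem_greenSide, Finset.mem_insert, Finset.mem_erase]
          grind [-Sum]
        have e2 : redSide D (insert a (C.erase b)) (o ∘ Equiv.swap a b) =
            moveTo a b (redSide D C o) := by
          ext y
          have := swapx o y
          have := swapa o
          simp only [mem_redSide, mem_moveTo, Finset.mem_insert, Finset.mem_erase]
          grind [-Sum]
        rw [e1, e2, if_neg (by tauto), if_pos (by tauto)]
        ring
  · convert hF using 2 with o
    rw [if_neg, if_neg, add_zero, add_zero]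
    · simp [mem_redSide, hbD, hbC]
    · simp [mem_greenSide, hbD, hbC]

open Classical in
/-- Before any hop the upper points are the lower points; the coloured points are then matched
vertically, by nested chords. -/
theorem isPlanarPairing_diagonal :
    IsPlanarPairing fun P Q => (if P.toLeft = P.toRight then (1 : R) else 0) *
      if Q.toLeft = Q.toRight then 1 else 0 := by
  intro D C hDC
  have hdis : ∀ y, y ∈ D → y ∉ C := fun y h => Finset.disjoint_left.1 hDC h
  by_cases h : D.toLeft = D.toRight ∧ C.toLeft = C.toRight
  · have hD : ∀ x : ℤ, (Sum.inl x : Point) ∈ D ↔ (Sum.inr x : Point) ∈ D := fun x => by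
      rw [← Finset.mem_toLeft, ← Finset.mem_toRight, h.1]
    have hC : ∀ x : ℤ, (Sum.inl x : Point) ∈ C ↔ (Sum.inr x : Point) ∈ C := fun x => by
      rw [← Finset.mem_toLeft, ← Finset.mem_toRight, h.2]
    have hm : IsPlanarMatching C Sum.swap := by
      refine ⟨?_, ?_, ?_, ?_⟩
      · rintro (y | y) hy
        · exact (hC y).1 hy
        · exact (hC y).2 hy
      · rintro (y | y) - <;> rfl
      · rintro (y | y) - <;> simp
      · rintro (y | y) - (z | z) - <;> simp [Encloses, Precedes] <;> omega
    convert compatible_mem (R := R) hm using 1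
    funext o
    unfold compatible
    dsimp only
    rw [ite_zero_mul_ite_zero, one_mul]
    refine if_congr ?_ rfl rfl
    simp only [Finset.ext_iff, Finset.mem_toLeft, Finset.mem_toRight, mem_greenSide, mem_redSide]
    have hl : ∀ (x : ℤ) (u : Orientation), IsGreen (Sum.inl x) u ↔ u = .inward :=
      fun x u => Iff.rfl
    simp only [hl, isGreen_inr]
    constructor
    · rintro ⟨h1, h2⟩ (y | y) hy
      · have := h1 y
        have := h2 y
        have := hC y
        have := hD y
        have := hdis _ |>.mt (not_not.2 hy)
        have := (hC y).1 hy
        simp only [Sum.swap_inl]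
        cases h3 : o (.inl y) <;> cases h4 : o (.inr y) <;> simp_all
      · have := h1 y
        have := h2 y
        have := hC y
        have := hD y
        have := hdis _ |>.mt (not_not.2 hy)
        have := (hC y).2 hy
        simp only [Sum.swap_inr]
        cases h3 : o (.inl y) <;> cases h4 : o (.inr y) <;> simp_all
    · intro h0
      constructor <;> intro y
      all_goals
        have h1 := h0 (.inl y)
        simp only [Sum.swap_inl] at h1
        rw [← hD, ← hC]
        by_cases hy : (Sum.inl y : Point) ∈ C
        · have := h1 hy
          cases h3 : o (.inl y) <;> cases h4 : o (.inr y) <;> simp_all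
        · simp [hy]
  · convert (planarSpan R C).zero_mem using 1
    funext o
    dsimp only
    rw [ite_zero_mul_ite_zero, if_neg]
    · rfl
    · rintro ⟨h1, h2⟩
      refine h ⟨?_, ?_⟩ <;> ext x
      all_goals
        have h1 := Finset.ext_iff.1 h1 x
        have h2 := Finset.ext_iff.1 h2 x
        have h3 := hdis (.inl x)
        have h4 := hdis (.inr x)
        simp only [Finset.mem_toLeft, Finset.mem_toRight, mem_greenSide, mem_redSide] at h1 h2 ⊢
        tauto

/-! ### Growing tableaux box by box -/

namespace SkewShape

theorem mem_cells {A : SkewShape} {i : Fin A.rows} {j : ℤ} :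
    (i, j) ∈ A.cells ↔ A.inner i < j ∧ j ≤ A.outer i := by
  simp only [cells, Finset.mem_biUnion, Finset.mem_image, Finset.mem_univ, true_and,
    Finset.mem_Ioc, Prod.mk.injEq]
  constructor
  · rintro ⟨i', j', h, rfl, rfl⟩
    exact h
  · exact fun h => ⟨i, j, h, rfl, rfl⟩

theorem inl_mem_points {A : SkewShape} {x : ℤ} :
    .inl x ∈ A.points ↔ ∃ i, A.inner i - (i : ℤ) - 1 = x := by
  simp [points]

theorem inr_mem_points {A : SkewShape} {x : ℤ} :
    .inr x ∈ A.points ↔ ∃ i, A.outer i - (i : ℤ) - 1 = x := by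
  simp [points]

end SkewShape

theorem strictAnti_shift {k : ℕ} {f : Fin k → ℤ} (hf : Antitone f) :
    StrictAnti fun i : Fin k => f i - (i : ℤ) - 1 := by
  intro i j hij
  have h1 := hf hij.le
  have h2 : (i : ℕ) < j := hij
  simp only
  omega

theorem eq_of_image_shift_eq {k : ℕ} {f g : Fin k → ℤ} (hf : Antitone f) (hg : Antitone g)
    (h : Finset.univ.image (fun i => f i - (i : ℤ) - 1) =
      Finset.univ.image fun i => g i - (i : ℤ) - 1) : f = g := by
  have h1 := (strictAnti_shift hf).dual_right
  have h2 := (strictAnti_shift hg).dual_right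
  have h3 := (StrictMono.range_inj h1 h2).1 (by
    ext x
    have := Finset.ext_iff.1 h (OrderDual.ofDual x)
    simp only [Finset.mem_image, Finset.mem_univ, true_and] at this
    exact this)
  funext i
  have := congrArg OrderDual.ofDual (congrFun h3 i)
  simp only [Function.comp, OrderDual.ofDual_toDual] at this
  omega

theorem prod_coe_insert {α M : Type*} [DecidableEq α] [CommMonoid M] {s t : Finset α} {a : α}
    (hs : t = insert a s) (ha : a ∉ s) (f : t → M) :
    ∏ c : t, f c = f ⟨a, by simp [hs]⟩ * ∏ c : s, f ⟨c.1, by simp [hs]⟩ := by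
  classical
  subst hs
  let g : α → M := fun x => if h : x ∈ insert a s then f ⟨x, h⟩ else 1
  have h1 : ∏ c : ↥(insert a s), f c = ∏ c ∈ insert a s, g c := by
    rw [← Finset.prod_coe_sort (insert a s) g]
    refine Fintype.prod_congr _ _ fun c => ?_
    simp only [g, c.2, dite_true]
  have h2 : ∏ c : s, f ⟨c.1, by simp⟩ = ∏ c ∈ s, g c := by
    rw [← Finset.prod_coe_sort s g]
    refine Fintype.prod_congr _ _ fun c => ?_
    have : c.1 ∈ insert a s := by simp
    simp only [g, this, dite_true]
  rw [h1, h2, Finset.prod_insert ha]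
  simp [g]

namespace SkewShape

theorem points_injective : Function.Injective points := by
  rintro ⟨r, f, g, hf, hg⟩ ⟨r', f', g', hf', hg'⟩ h
  have hl := congrArg Finset.toLeft h
  have hr := congrArg Finset.toRight h
  simp only [points, Finset.toLeft_disjSum, Finset.toRight_disjSum] at hl hr
  have hc := congrArg Finset.card hr
  rw [Finset.card_image_of_injective _ (strictAnti_shift hf).injective,
    Finset.card_image_of_injective _ (strictAnti_shift hf').injective, Finset.card_fin,
    Finset.card_fin] at hc
  subst hc
  obtain rfl := eq_of_image_shift_eq hf hf' hr
  obtain rfl := eq_of_image_shift_eq hg hg' hl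
  rfl

/-- The abscissa of the place from which the upper end point of a row moves when the given cell is
added to the end of the row. -/
def content {r : ℕ} (c : Fin r × ℤ) : ℤ := c.2 - c.1 - 2

open Classical in
/-- The generating function of the semistandard tableaux of the given shape such that the pairs
formed by the entry and the content of a cell all belong to `U`. -/
noncomputable def partialSchur {n : ℕ} (U : Finset (Fin n ×ₗ ℤ)) (A : SkewShape) :
    MvPolynomial (Fin n) ℤ :=
  if ∀ i, A.inner i ≤ A.outer i then
    ∑ T : A.cells → Fin n with A.IsSemistandard T ∧ ∀ c, toLex (T c, content c.1) ∈ U,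
      ∏ c : A.cells, MvPolynomial.X (T c)
  else 0

theorem partialSchur_eq_schur {n : ℕ} {U : Finset (Fin n ×ₗ ℤ)} {A : SkewShape}
    (h : ∀ (k : Fin n) (c : A.cells), toLex (k, content c.1) ∈ U) :
    A.partialSchur U = A.schur n := by
  classical
  unfold partialSchur schur
  refine if_congr Iff.rfl (Finset.sum_congr ?_ fun _ _ => rfl) rfl
  refine Finset.filter_congr fun T _ => ?_
  simp [h]

/-- Cells with the lexicographically largest pair of entry and content are corners of the shape. -/
theorem IsSemistandard.corner {A : SkewShape} {n : ℕ}
    {T : A.cells → Fin n} (hT : A.IsSemistandard T) {k : Fin n} {p : ℤ}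
    (hmax : ∀ c, toLex (T c, content c.1) ≤ toLex (k, p)) {i : Fin A.rows} {j : ℤ}
    (hc : (i, j) ∈ A.cells) (hk : T ⟨(i, j), hc⟩ = k) (hp : content (i, j) = p) :
    A.outer i = j ∧ ∀ i', i < i' → A.outer i' < j := by
  have hc' := mem_cells.1 hc
  have hmax' : ∀ c, T c < k ∨ T c = k ∧ content c.1 ≤ p := fun c =>
    Prod.Lex.toLex_le_toLex.1 (hmax c)
  simp only [content] at hp
  constructor
  · by_contra hne
    have hd : (i, j + 1) ∈ A.cells := mem_cells.2 (by omega)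
    have h1 := hT.1 ⟨(i, j), hc⟩ ⟨(i, j + 1), hd⟩ rfl (by simp)
    rw [hk] at h1
    rcases hmax' ⟨(i, j + 1), hd⟩ with h2 | ⟨-, h2⟩
    · exact absurd h1 (not_le.2 h2)
    · simp only [content] at h2
      omega
  · intro i' hi
    by_contra hlt
    have h0 := A.inner_antitone hi.le
    have hd : (i', j) ∈ A.cells := mem_cells.2 (by omega)
    have h1 := hT.2 ⟨(i, j), hc⟩ ⟨(i', j), hd⟩ rfl hi
    rw [hk] at h1
    rcases hmax' ⟨(i', j), hd⟩ with h2 | ⟨h2, -⟩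
    · exact absurd h1 (not_lt.2 h2.le)
    · exact h1.ne' h2

open Classical in
/-- Adding an admissible pair adds the tableaux in which it occurs. -/
theorem partialSchur_insert {A : SkewShape} (hA : ∀ i, A.inner i ≤ A.outer i) {n : ℕ}
    (U : Finset (Fin n ×ₗ ℤ)) {u : Fin n ×ₗ ℤ} (hu : u ∉ U) :
    A.partialSchur (insert u U) = A.partialSchur U +
      ∑ T : A.cells → Fin n with (A.IsSemistandard T ∧
        ∀ c, toLex (T c, content c.1) ∈ insert u U) ∧ ∃ c, toLex (T c, content c.1) = u,
        ∏ c : A.cells, MvPolynomial.X (T c) := by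
  classical
  unfold partialSchur
  rw [if_pos hA, if_pos hA]
  rw [← Finset.sum_filter_not_add_sum_filter _ fun T : A.cells → Fin n =>
    ∃ c, toLex (T c, content c.1) = u]
  rw [Finset.filter_filter, Finset.filter_filter]
  congr 1
  · refine Finset.sum_congr (Finset.filter_congr fun T _ => ?_) fun _ _ => rfl
    simp only [Finset.mem_insert, not_exists, and_assoc]
    refine and_congr_right fun _ => ?_
    constructor
    · rintro ⟨h1, h2⟩ c
      exact (h1 c).resolve_left (h2 c)
    · intro h
      exact ⟨fun c => Or.inr (h c), fun c hc => hu (hc ▸ h c)⟩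

/-- Remove the last box of row `i`, which must be longer than the rows below it. -/
abbrev shorten (A : SkewShape) (i : Fin A.rows) (h : ∀ i', i < i' → A.outer i' < A.outer i) :
    SkewShape where
  rows := A.rows
  outer := Function.update A.outer i (A.outer i - 1)
  inner := A.inner
  outer_antitone := by
    intro x y hxy
    have h1 := A.outer_antitone hxy
    have h2 := h y
    simp only [Function.update_apply]
    split_ifs with h3 h4 h4
    · rfl
    · subst h3; omega
    · subst h4
      have := h2 (lt_of_le_of_ne hxy (Ne.symm h3))
      omega
    · exact h1
  inner_antitone := A.inner_antitone

theorem points_shorten (A : SkewShape) (i : Fin A.rows)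
    (h : ∀ i', i < i' → A.outer i' < A.outer i) {p : ℤ} (hp : A.outer i - (i : ℤ) - 1 = p + 1) :
    (A.shorten i h).points = moveTo (.inr p) (.inr (p + 1)) A.points := by
  have hinj := (strictAnti_shift A.outer_antitone).injective
  ext (x | x)
  · rw [inl_mem_points, mem_moveTo, inl_mem_points]
    simp [shorten]
  · rw [inr_mem_points, mem_moveTo, inr_mem_points]
    simp only [shorten, Sum.inr.injEq, ne_eq]
    constructor
    · rintro ⟨i', rfl⟩
      by_cases hi : i' = i
      · subst hi
        left
        simp only [Function.update_self]
        omega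
      · right
        rw [Function.update_of_ne hi]
        refine ⟨fun h' => hi (hinj ?_), i', rfl⟩
        simp only
        omega
    · rintro (rfl | ⟨h1, i', rfl⟩)
      · exact ⟨i, by simp only [Function.update_self]; omega⟩
      · refine ⟨i', ?_⟩
        rw [Function.update_of_ne]
        rintro rfl
        exact h1 hp

theorem cells_shorten (A : SkewShape) (i : Fin A.rows)
    (h : ∀ i', i < i' → A.outer i' < A.outer i) (hi : A.inner i < A.outer i) :
    A.cells = insert (i, A.outer i) ((A.shorten i h).cells : Finset (Fin A.rows × ℤ)) := by
  ext ⟨i', j⟩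
  rw [mem_cells, Finset.mem_insert]
  have : ((i', j) ∈ (A.shorten i h).cells) ↔ _ := mem_cells (A := A.shorten i h) (i := i')
  rw [this]
  simp only [Prod.mk.injEq, Function.update_apply]
  split_ifs with h1
  · subst h1; simp; omega
  · simp [h1]

theorem outer_notMem_cells_shorten (A : SkewShape) (i : Fin A.rows)
    (h : ∀ i', i < i' → A.outer i' < A.outer i) :
    (i, A.outer i) ∉ (A.shorten i h).cells := by
  have : ((i, A.outer i) ∈ (A.shorten i h).cells) ↔ _ := mem_cells (A := A.shorten i h) (i := i)
  rw [this]
  simp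

/-- If the largest admissible pair of entry and content occurs in a tableau, then it occurs in a
corner, and removing this box leaves a tableau in which it does not occur. -/
theorem partialSchur_insert_of_corner (A : SkewShape) {n : ℕ} {U : Finset (Fin n ×ₗ ℤ)}
    {k : Fin n} {p : ℤ} (hU : ∀ u ∈ U, u < toLex (k, p)) (i : Fin A.rows)
    (h : ∀ i', i < i' → A.outer i' < A.outer i) (hp : A.outer i - (i : ℤ) - 1 = p + 1) :
    A.partialSchur (insert (toLex (k, p)) U) =
      A.partialSchur U + MvPolynomial.X k * (A.shorten i h).partialSchur U := by
  classical
  have huU : toLex (k, p) ∉ U := fun hu => lt_irrefl _ (hU _ hu)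
  by_cases hA : ∀ i, A.inner i ≤ A.outer i
  swap
  · have hA' : ¬ ∀ i', (A.shorten i h).inner i' ≤ (A.shorten i h).outer i' := by
      intro h'
      refine hA fun i' => (h' i').trans ?_
      simp only [Function.update_apply]
      split_ifs with h1
      · subst h1; omega
      · rfl
    unfold partialSchur
    rw [if_neg hA, if_neg hA, if_neg hA']
    simp
  have hinj := (strictAnti_shift A.outer_antitone).injective
  have hle : ∀ u ∈ insert (toLex (k, p)) U, u ≤ toLex (k, p) := by
    intro u hu
    rcases Finset.mem_insert.1 hu with rfl | hu
    · exact le_rfl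
    · exact (hU u hu).le
  -- the largest pair can only occur in the last box of row `i`
  have key : ∀ T : A.cells → Fin n, A.IsSemistandard T →
      (∀ c, toLex (T c, content c.1) ∈ insert (toLex (k, p)) U) → ∀ c : A.cells,
      toLex (T c, content c.1) = toLex (k, p) → c.1 = (i, A.outer i) := by
    rintro T hT hTU ⟨⟨i', j⟩, hc⟩ hcu
    have hcu' := Prod.mk.inj (toLex.injective hcu)
    have h1 := hT.corner (fun c => hle _ (hTU c)) hc hcu'.1 hcu'.2
    have h2 := hcu'.2
    simp only [content] at h2
    have h3 : i' = i := hinj (by simp only; omega)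
    subst h3
    simp [h1.1]
  rw [partialSchur_insert hA U huU]
  congr 1
  rcases (hA i).eq_or_lt with hi | hi
  · unfold partialSchur
    rw [if_neg, mul_zero, Finset.sum_eq_zero]
    · intro T hT
      obtain ⟨⟨hT, hTU⟩, c, hc⟩ := (Finset.mem_filter.1 hT).2
      have h1 := key T hT hTU c hc
      have h2 := c.2
      rw [h1, mem_cells] at h2
      omega
    · intro h'
      have := h' i
      simp only [Function.update_self] at this
      omega
  have hA' : ∀ i', A.inner i' ≤ Function.update A.outer i (A.outer i - 1) i' := by
    intro i'
    simp only [Function.update_apply]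
    split_ifs with h1
    · subst h1; omega
    · exact hA i'
  have hcells := A.cells_shorten i h hi
  have hbox := A.outer_notMem_cells_shorten i h
  have hmem : ∀ c, c ∈ A.cells ↔ c = (i, A.outer i) ∨ c ∈ (A.shorten i h).cells := fun c => by
    rw [hcells, Finset.mem_insert]
  have hboxA : (i, A.outer i) ∈ A.cells := by simp [hcells]
  have hsub : ∀ c ∈ (A.shorten i h).cells, c ∈ A.cells := fun c hc => by
    rw [hcells]
    exact Finset.mem_insert_of_mem hc
  unfold partialSchur
  rw [if_pos hA', Finset.mul_sum]
  refine Finset.sum_bij' (fun T _ c => T ⟨c.1, hsub _ c.2⟩)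
    (fun T' _ c => if hc : c.1 ∈ (A.shorten i h).cells then T' ⟨c.1, hc⟩ else k) ?_ ?_ ?_ ?_ ?_
  · intro T hT
    obtain ⟨⟨hT, hTU⟩, c, hc⟩ := (Finset.mem_filter.1 hT).2
    refine Finset.mem_filter.2 ⟨Finset.mem_univ _, ⟨?_, ?_⟩, ?_⟩
    · exact fun x y => hT.1 ⟨x.1, hsub _ x.2⟩ ⟨y.1, hsub _ y.2⟩
    · exact fun x y => hT.2 ⟨x.1, hsub _ x.2⟩ ⟨y.1, hsub _ y.2⟩
    · intro x
      refine (Finset.mem_insert.1 (hTU ⟨x.1, hsub _ x.2⟩)).resolve_left fun hx => ?_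
      have := key T hT hTU _ hx
      exact hbox (this ▸ x.2)
  · intro T' hT'
    obtain ⟨hT', hTU⟩ := (Finset.mem_filter.1 hT').2
    have hnew : ∀ c : A.cells, c.1 ∉ (A.shorten i h).cells → c.1 = (i, A.outer i) := by
      intro c hc
      exact ((hmem _).1 c.2).resolve_right hc
    have hlt : ∀ c, toLex (T' c, content c.1) < toLex (k, p) := fun c => hU _ (hTU c)
    refine Finset.mem_filter.2 ⟨Finset.mem_univ _, ⟨⟨?_, ?_⟩, ?_⟩, ⟨⟨_, hboxA⟩, ?_⟩⟩
    · intro x y hxy1 hxy2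
      by_cases hx : x.1 ∈ (A.shorten i h).cells <;> by_cases hy : y.1 ∈ (A.shorten i h).cells
      · simp only [hx, hy, dite_true]
        exact hT'.1 _ _ hxy1 hxy2
      · simp only [hx, hy, dite_true, dite_false]
        have := hlt ⟨x.1, hx⟩
        rw [Prod.Lex.toLex_lt_toLex] at this
        rcases this with h1 | h1
        · exact h1.le
        · exact h1.1.le
      · -- the new box is the last one of its row
        exfalso
        have h1 := hnew x hx
        have h2 := y.2
        obtain ⟨⟨y1, y2⟩, hyA⟩ := y
        simp only [h1] at hxy1 hxy2 h2
        subst hxy1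
        rw [mem_cells] at h2
        have h3 : y2 = A.outer i := by omega
        exact hbox (h3 ▸ hy)
      · simp only [hx, hy, dite_false, le_refl]
    · intro x y hxy1 hxy2
      by_cases hx : x.1 ∈ (A.shorten i h).cells <;> by_cases hy : y.1 ∈ (A.shorten i h).cells
      · simp only [hx, hy, dite_true]
        exact hT'.2 _ _ hxy1 hxy2
      · -- cells above the new box have larger content, hence a smaller entry
        simp only [hx, hy, dite_true, dite_false]
        have h1 := hlt ⟨x.1, hx⟩
        rw [Prod.Lex.toLex_lt_toLex] at h1
        rcases h1 with h1 | h1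
        · exact h1
        · exfalso
          have h2 := h1.2
          have h3 := hnew y hy
          rw [h3] at hxy1 hxy2
          have h4 : (x.1.1 : ℕ) < i := hxy2
          simp only [content, hxy1] at h2
          omega
      · -- the rows below the new box are too short
        exfalso
        have h1 := hnew x hx
        rw [h1] at hxy1 hxy2
        have h2 := h _ hxy2
        have h3 := y.2
        obtain ⟨⟨y1, y2⟩, hyA⟩ := y
        rw [mem_cells] at h3
        simp only at hxy1 h2
        omega
      · exfalso
        rw [hnew x hx, hnew y hy] at hxy2
        exact lt_irrefl _ hxy2
    · intro c
      by_cases hc : c.1 ∈ (A.shorten i h).cells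
      · simp only [hc, dite_true]
        exact Finset.mem_insert_of_mem (hTU ⟨c.1, hc⟩)
      · simp only [hc, dite_false]
        rw [hnew c hc]
        have : content (i, A.outer i) = p := by
          simp only [content]
          omega
        rw [this]
        exact Finset.mem_insert_self _ _
    · simp only [hbox, dite_false]
      congr 2
      simp only [content]
      omega
  · intro T hT
    obtain ⟨⟨hT, hTU⟩, c, hc⟩ := (Finset.mem_filter.1 hT).2
    have h1 := key T hT hTU c hc
    have h2 : T c = k := (Prod.mk.inj (toLex.injective hc)).1
    funext x
    by_cases hx : x.1 ∈ (A.shorten i h).cells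
    · simp only [hx, dite_true]
    · simp only [hx, dite_false]
      rw [← h2]
      congr 1
      exact Subtype.ext (h1.trans (((hmem _).1 x.2).resolve_right hx).symm)
  · intro T' _
    funext x
    simp
  · intro T hT
    obtain ⟨⟨hT, hTU⟩, c, hc⟩ := (Finset.mem_filter.1 hT).2
    have h1 := key T hT hTU c hc
    have h2 : T c = k := (Prod.mk.inj (toLex.injective hc)).1
    have h3 : c = ⟨(i, A.outer i), hboxA⟩ := Subtype.ext h1
    rw [prod_coe_insert hcells hbox, ← h3, h2]

theorem partialSchur_insert_of_not_corner (A : SkewShape) {n : ℕ} {U : Finset (Fin n ×ₗ ℤ)}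
    {k : Fin n} {p : ℤ} (hU : ∀ u ∈ U, u < toLex (k, p))
    (h : ¬ (.inr (p + 1) ∈ A.points ∧ .inr p ∉ A.points)) :
    A.partialSchur (insert (toLex (k, p)) U) = A.partialSchur U := by
  classical
  have huU : toLex (k, p) ∉ U := fun hu => lt_irrefl _ (hU _ hu)
  by_cases hA : ∀ i, A.inner i ≤ A.outer i
  swap
  · unfold partialSchur
    rw [if_neg hA, if_neg hA]
  rw [partialSchur_insert hA U huU, Finset.sum_eq_zero, add_zero]
  intro T hT
  obtain ⟨⟨hT, hTU⟩, ⟨⟨i, j⟩, hcA⟩, hc⟩ := (Finset.mem_filter.1 hT).2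
  exfalso
  have hcu' := Prod.mk.inj (toLex.injective hc)
  have h1 := hT.corner (fun c => by
    rcases Finset.mem_insert.1 (hTU c) with hu | hu
    · exact hu.le
    · exact (hU _ hu).le) hcA hcu'.1 hcu'.2
  have h2 := hcu'.2
  simp only [content] at h2
  refine h ⟨inr_mem_points.2 ⟨i, by omega⟩, fun h' => ?_⟩
  obtain ⟨i', hi'⟩ := inr_mem_points.1 h'
  have h3 : i < i' := (strictAnti_shift A.outer_antitone).lt_iff_gt.1 (by omega)
  have h4 := h1.2 i' h3
  have h5 : (i : ℕ) < i' := h3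
  omega

theorem partialSchur_empty (A : SkewShape) (n : ℕ)
    [Decidable (A.points.toLeft = A.points.toRight)] :
    A.partialSchur (∅ : Finset (Fin n ×ₗ ℤ)) =
      if A.points.toLeft = A.points.toRight then 1 else 0 := by
  classical
  have h : A.points.toLeft = A.points.toRight ↔ A.inner = A.outer := by
    simp only [points, Finset.toLeft_disjSum, Finset.toRight_disjSum]
    exact ⟨eq_of_image_shift_eq A.inner_antitone A.outer_antitone, fun h => by rw [h]⟩
  unfold partialSchur
  split_ifs with h1 h2 h2
  · have : IsEmpty A.cells := ⟨fun ⟨⟨i, j⟩, hc⟩ => by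
      rw [mem_cells, h.1 h2] at hc
      omega⟩
    rw [Finset.filter_true_of_mem]
    · simp
    · exact fun T _ => ⟨⟨fun x => isEmptyElim x, fun x => isEmptyElim x⟩, fun x => isEmptyElim x⟩
  · rw [Finset.sum_eq_zero]
    intro T hT
    obtain ⟨-, hT⟩ := (Finset.mem_filter.1 hT).2
    exfalso
    refine h2 (h.2 (funext fun i => ?_))
    by_contra hi
    exact Finset.notMem_empty _
      (hT ⟨(i, A.outer i), mem_cells.2 ⟨lt_of_le_of_ne (h1 i) hi, le_rfl⟩⟩)
  · exact absurd (fun i => (congrFun (h.1 h2) i).le) h1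
  · rfl

end SkewShape

theorem points_shapeOfPoints (P : Finset Point) (h : P.toLeft.card = P.toRight.card) :
    (shapeOfPoints P h).points = P := by
  have aux : ∀ (s : Finset ℤ) {k : ℕ} (hk : s.card = k) (x : ℤ),
      (∃ i : Fin k, s.orderEmbOfFin hk i.rev + (i : ℤ) + 1 - (i : ℤ) - 1 = x) ↔ x ∈ s := by
    intro s k hk x
    have h1 : x ∈ s ↔ x ∈ Set.range (s.orderEmbOfFin hk) := by
      rw [Finset.range_orderEmbOfFin]; simp
    rw [h1]
    constructor
    · rintro ⟨i, hi⟩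
      exact ⟨i.rev, by omega⟩
    · rintro ⟨i, hi⟩
      refine ⟨i.rev, ?_⟩
      rw [Fin.rev_rev]
      omega
  ext (x | x)
  · rw [SkewShape.inl_mem_points, ← Finset.mem_toLeft]
    exact aux P.toLeft h x
  · rw [SkewShape.inr_mem_points, ← Finset.mem_toRight]
    exact aux P.toRight rfl x

/-- `SkewShape.partialSchur` as a function of the set of points of the shape; it is `0` if there is
no such shape. -/
noncomputable def pointSchur {n : ℕ} (U : Finset (Fin n ×ₗ ℤ)) (P : Finset Point) :
    MvPolynomial (Fin n) ℤ :=
  if h : P.toLeft.card = P.toRight.card then (shapeOfPoints P h).partialSchur U else 0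

theorem card_moveTo {P : Finset Point} {p : ℤ} (h1 : .inr (p + 1) ∈ P) (h2 : .inr p ∉ P) :
    (moveTo (.inr p) (.inr (p + 1)) P).toLeft.card = P.toLeft.card ∧
      (moveTo (.inr p) (.inr (p + 1)) P).toRight.card = P.toRight.card := by
  have e1 : (moveTo (.inr p) (.inr (p + 1)) P).toLeft = P.toLeft := by
    ext x
    simp [mem_moveTo]
  have e2 : (moveTo (.inr p) (.inr (p + 1)) P).toRight = insert p (P.toRight.erase (p + 1)) := by
    ext x
    simp [mem_moveTo]
  rw [e1, e2, Finset.card_insert_of_notMem (by simp [h2]), Finset.card_erase_add_one (by simpa)]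
  exact ⟨rfl, rfl⟩

theorem pointSchur_insert {n : ℕ} {U : Finset (Fin n ×ₗ ℤ)} {k : Fin n} {p : ℤ}
    (hU : ∀ u ∈ U, u < toLex (k, p)) :
    pointSchur (insert (toLex (k, p)) U) = hop (MvPolynomial.X k) p (pointSchur U) := by
  funext P
  unfold hop pointSchur
  by_cases hP : P.toLeft.card = P.toRight.card
  · rw [dif_pos hP, dif_pos hP]
    set A := shapeOfPoints P hP with hAdef
    have hA : A.points = P := points_shapeOfPoints P hP
    split_ifs with h1 h2
    · rw [← hA, SkewShape.inr_mem_points] at h1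
      obtain ⟨⟨i, hi⟩, hn⟩ := h1
      have h : ∀ i', i < i' → A.outer i' < A.outer i := by
        intro i' hi'
        have h1 := A.outer_antitone hi'.le
        refine lt_of_le_of_ne h1 fun h2 => hn (SkewShape.inr_mem_points.2 ⟨⟨i + 1, ?_⟩, ?_⟩)
        · have := i'.2
          have : (i : ℕ) < i' := hi'
          omega
        · have h3 : i ≤ (⟨i + 1, by have := i'.2; have : (i : ℕ) < i' := hi'; omega⟩ :
            Fin A.rows) := by rw [Fin.le_def]; simp
          have h4 : (⟨i + 1, by have := i'.2; have : (i : ℕ) < i' := hi'; omega⟩ :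
            Fin A.rows) ≤ i' := by rw [Fin.le_def]; exact hi'
          have h5 := A.outer_antitone h3
          have h6 := A.outer_antitone h4
          push_cast
          omega
      rw [A.partialSchur_insert_of_corner hU i h hi]
      congr 3
      apply SkewShape.points_injective
      rw [points_shapeOfPoints, A.points_shorten i h hi, hA]
    · exact absurd ((card_moveTo h1.1 h1.2).1.trans
        (hP.trans (card_moveTo h1.1 h1.2).2.symm)) h2
    · rw [add_zero]
      exact A.partialSchur_insert_of_not_corner hU (by rwa [hA])
  · rw [dif_neg hP, dif_neg hP]
    split_ifs with h1 h2
    · exact absurd ((card_moveTo h1.1 h1.2).1.symm.trans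
        (h2.trans (card_moveTo h1.1 h1.2).2)) hP
    · simp
    · simp

open Classical in
theorem pointSchur_empty (n : ℕ) (P : Finset Point) :
    pointSchur (∅ : Finset (Fin n ×ₗ ℤ)) P = if P.toLeft = P.toRight then 1 else 0 := by
  unfold pointSchur
  split_ifs with h1 h2 h2
  · rw [SkewShape.partialSchur_empty, points_shapeOfPoints, if_pos h2]
  · rw [SkewShape.partialSchur_empty, points_shapeOfPoints, if_neg h2]
  · exact absurd (congrArg _ h2) h1
  · rfl

theorem isPlanarPairing_pointSchur {n : ℕ} (U : Finset (Fin n ×ₗ ℤ)) :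
    IsPlanarPairing fun P Q => pointSchur U P * pointSchur U Q := by
  induction U using Finset.induction_on_max with
  | empty =>
    simp only [pointSchur_empty]
    exact isPlanarPairing_diagonal
  | insert u U hU ih =>
    obtain ⟨⟨k, p⟩, rfl⟩ := toLex.surjective u
    rw [pointSchur_insert hU]
    exact ih.hop _ _

/-! ### The recolouring graph -/

theorem Orientation.flip_flip (o : Orientation) : o.flip.flip = o := by cases o <;> rfl

theorem Orientation.flip_ne (o : Orientation) : o.flip ≠ o := by cases o <;> simp [flip]

theorem Orientation.flip_injective : Function.Injective Orientation.flip :=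
  Function.LeftInverse.injective flip_flip

theorem Orientation.eq_flip_of_ne {x y : Orientation} (h : x ≠ y) : x = y.flip := by
  cases x <;> cases y <;> simp_all [flip]

variable {A B : SkewShape} {S : Finset (coloured A B)} {r : RadialOrientation A B}
  {m : coloured A B → coloured A B}

theorem IsNoncrossingMatching.admissible (h : IsNoncrossingMatching r m) : Admissible r := by
  unfold Admissible
  refine Finset.card_bij' (fun p _ => m p) (fun p _ => m p) ?_ ?_ ?_ ?_
  · intro p hp
    have h1 := h.orientation_ne p
    simp only [Finset.mem_filter, Finset.mem_univ, true_and] at hp ⊢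
    rw [Orientation.eq_flip_of_ne h1, hp]
    rfl
  · intro p hp
    have h1 := h.orientation_ne p
    simp only [Finset.mem_filter, Finset.mem_univ, true_and] at hp ⊢
    rw [Orientation.eq_flip_of_ne h1, hp]
    rfl
  · exact fun p _ => h.involutive p
  · exact fun p _ => h.involutive p

theorem reverseEdges_of_mem {p : coloured A B} (hp : p ∈ S) : reverseEdges S m r p = (r p).flip :=
  if_pos (Or.inl hp)

theorem reverseEdges_reverseEdges : reverseEdges S m (reverseEdges S m r) = r := by
  funext p
  unfold reverseEdges
  split_ifs
  · exact Orientation.flip_flip _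
  · rfl

theorem IsNoncrossingMatching.reverseEdges (h : IsNoncrossingMatching r m) :
    IsNoncrossingMatching (reverseEdges S m r) m where
  involutive := h.involutive
  noncrossing := h.noncrossing
  orientation_ne p := by
    have h1 := h.orientation_ne p
    simp only [DodgsonScheme.reverseEdges, h.involutive p, or_comm (a := m p ∈ S)]
    split_ifs
    · exact fun h2 => h1 (Orientation.flip_injective h2)
    · exact h1

/-- The vertex reached from `v` by the recolouring scheme for the matching `m`. -/
def Vertex.recolour (v : Vertex A B S) (h : IsNoncrossingMatching v.1 m) : Vertex A B S :=
  ⟨reverseEdges S m v.1, h.reverseEdges.admissible, by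
    obtain ⟨o, ho⟩ := v.2.2
    exact ⟨o.flip, fun p hp => by rw [reverseEdges_of_mem hp, ho p hp]⟩⟩

theorem Vertex.adj_recolour (hS : S.Nonempty) (v : Vertex A B S)
    (h : IsNoncrossingMatching v.1 m) : (recolouringGraph A B S).Adj v (v.recolour h) := by
  rw [recolouringGraph, SimpleGraph.fromRel_adj]
  refine ⟨fun hv => ?_, Or.inl ⟨m, h, rfl⟩⟩
  obtain ⟨p, hp⟩ := hS
  have h1 : v.1 p = (v.recolour h).1 p := by rw [← hv]
  exact Orientation.flip_ne _ ((reverseEdges_of_mem hp).symm.trans h1.symm)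

theorem Vertex.recolour_mem_orientedClass {v : Vertex A B S} (h : IsNoncrossingMatching v.1 m)
    {o : Orientation} (hv : v ∈ orientedClass A B S o) :
    v.recolour h ∈ orientedClass A B S o.flip := fun p hp => by
  rw [← hv p hp]
  exact reverseEdges_of_mem hp

/-- A radial orientation, extended to all points. -/
def extend (r : RadialOrientation A B) (p : Point) : Orientation :=
  if h : p ∈ coloured A B then r ⟨p, h⟩ else .inward

theorem extend_coe (r : RadialOrientation A B) (p : coloured A B) : extend r p.1 = r p := by
  simp [extend]

theorem greenSide_extend (r : RadialOrientation A B) :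
    greenSide (uncoloured A B) (coloured A B) (extend r) = greenPoints r := by
  ext p
  rw [mem_greenSide, greenPoints, Finset.mem_union]
  refine or_congr_right ?_
  simp only [Finset.mem_map, Finset.mem_filter, Finset.mem_univ, true_and,
    Function.Embedding.subtype_apply]
  constructor
  · rintro ⟨h1, h2⟩
    refine ⟨⟨p, h1⟩, ?_, rfl⟩
    rwa [← extend_coe r ⟨p, h1⟩]
  · rintro ⟨q, h1, rfl⟩
    exact ⟨q.2, by rwa [extend_coe]⟩

theorem redSide_extend (r : RadialOrientation A B) :
    redSide (uncoloured A B) (coloured A B) (extend r) = redPoints r := by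
  ext p
  rw [mem_redSide, redPoints, Finset.mem_union]
  refine or_congr_right ?_
  simp only [Finset.mem_map, Finset.mem_filter, Finset.mem_univ, true_and,
    Function.Embedding.subtype_apply]
  constructor
  · rintro ⟨h1, h2⟩
    refine ⟨⟨p, h1⟩, ?_, rfl⟩
    rwa [← extend_coe r ⟨p, h1⟩]
  · rintro ⟨q, h1, rfl⟩
    exact ⟨q.2, by rwa [extend_coe]⟩

theorem disjoint_uncoloured_coloured (A B : SkewShape) :
    Disjoint (uncoloured A B) (coloured A B) := by
  rw [Finset.disjoint_left]
  intro p
  simp only [uncoloured, coloured, Finset.mem_inter, Finset.mem_symmDiff]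
  tauto

/-- A noncrossing matching of the coloured points, as a function on the subtype. -/
def IsPlanarMatching.restrict {f : Point → Point} (hf : IsPlanarMatching (coloured A B) f)
    (p : coloured A B) : coloured A B :=
  ⟨f p.1, hf.mem p.1 p.2⟩

theorem IsPlanarMatching.isNoncrossingMatching_iff {f : Point → Point}
    (hf : IsPlanarMatching (coloured A B) f) :
    IsNoncrossingMatching r hf.restrict ↔
      ∀ p ∈ coloured A B, extend r (f p) ≠ extend r p := by
  constructor
  · intro h p hp
    have := h.orientation_ne ⟨p, hp⟩
    rwa [← extend_coe r, ← extend_coe r] at this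
  · intro h
    refine ⟨fun p => Subtype.ext (hf.invol p.1 p.2), fun p => ?_, fun p q h1 h2 h3 => ?_⟩
    · rw [← extend_coe r, ← extend_coe r]
      exact h p.1 p.2
    · have h2' : Precedes q.1 (f p.1) := h2
      have h3' : Precedes (f p.1) (f q.1) := h3
      have h4 := hf.planar p.1 p.2 q.1 q.2
        (fun h => by rw [h] at h1; exact h1.asymm h1)
        (fun h => by rw [← h] at h2'; exact h2'.asymm h2')
      have h5 := h2'.asymm
      have h6 := h1.trans (h2'.trans h3')
      unfold Encloses at h4
      tauto

open Classical in
/-- For a single noncrossing matching, the recolouring scheme is a bijection between the compatible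
orientations of both classes, and it does not leave connected components. -/
theorem sum_compatible_eq (hS : S.Nonempty)
    (Z : (recolouringGraph A B S).ConnectedComponent) {f : Point → Point}
    (hf : IsPlanarMatching (coloured A B) f) :
    ∑ v : Vertex A B S with v ∈ Z.supp ∩ orientedClass A B S .inward,
        compatible R (coloured A B) f (extend v.1) =
      ∑ v : Vertex A B S with v ∈ Z.supp ∩ orientedClass A B S .outward,
        compatible R (coloured A B) f (extend v.1) := by
  unfold compatible
  simp only [← hf.isNoncrossingMatching_iff]
  rw [← Finset.sum_filter, ← Finset.sum_filter, Finset.filter_filter, Finset.filter_filter]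
  have key : ∀ (v : Vertex A B S) (o : Orientation) (h : IsNoncrossingMatching v.1 hf.restrict),
      v ∈ Z.supp ∩ orientedClass A B S o →
        v.recolour h ∈ Z.supp ∩ orientedClass A B S o.flip := fun v o h hv =>
    ⟨Z.mem_supp_of_adj_mem_supp hv.1 (v.adj_recolour hS h),
      Vertex.recolour_mem_orientedClass h hv.2⟩
  refine Finset.sum_bij' (fun v hv => v.recolour (Finset.mem_filter.1 hv).2.2)
    (fun v hv => v.recolour (Finset.mem_filter.1 hv).2.2) ?_ ?_ ?_ ?_ ?_
  · intro v hv
    have hv' := (Finset.mem_filter.1 hv).2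
    exact Finset.mem_filter.2 ⟨Finset.mem_univ _, key v _ hv'.2 hv'.1, hv'.2.reverseEdges⟩
  · intro v hv
    have hv' := (Finset.mem_filter.1 hv).2
    exact Finset.mem_filter.2 ⟨Finset.mem_univ _, key v _ hv'.2 hv'.1, hv'.2.reverseEdges⟩
  · exact fun v _ => Subtype.ext reverseEdges_reverseEdges
  · exact fun v _ => Subtype.ext reverseEdges_reverseEdges
  · exact fun v _ => rfl

open Classical in
/-- By linearity, `sum_compatible_eq` extends to the span. -/
theorem sum_eq_of_mem_planarSpan (hS : S.Nonempty)
    (Z : (recolouringGraph A B S).ConnectedComponent) {φ : (Point → Orientation) → R}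
    (hφ : φ ∈ planarSpan R (coloured A B)) :
    ∑ v : Vertex A B S with v ∈ Z.supp ∩ orientedClass A B S .inward, φ (extend v.1) =
      ∑ v : Vertex A B S with v ∈ Z.supp ∩ orientedClass A B S .outward, φ (extend v.1) := by
  induction hφ using Submodule.span_induction with
  | mem φ h =>
    obtain ⟨f, hf, rfl⟩ := h
    exact sum_compatible_eq hS Z hf
  | zero => simp
  | add φ ψ _ _ h1 h2 => simp only [Pi.add_apply, Finset.sum_add_distrib, h1, h2]
  | smul c φ _ h => simp only [Pi.smul_apply, ← Finset.smul_sum, h]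

open Classical in
/-- All pairs formed by an entry and the content of a cell of a shape of one of the vertices. -/
noncomputable def entryContents (n : ℕ) (A B : SkewShape) (S : Finset (coloured A B)) :
    Finset (Fin n ×ₗ ℤ) :=
  Finset.univ.biUnion fun v : Vertex A B S =>
    (Finset.univ.image fun x : Fin n × (greenShape v.1 v.2.1).cells =>
      toLex (x.1, SkewShape.content x.2.1)) ∪
    (Finset.univ.image fun x : Fin n × (redShape v.1 v.2.1).cells =>
      toLex (x.1, SkewShape.content x.2.1))

/-- The pairs in `entryContents` impose no condition on the tableaux of the vertices. -/
theorem schurProduct_eq (n : ℕ) (v : Vertex A B S) :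
    schurProduct n v = pointSchur (entryContents n A B S) (greenPoints v.1) *
      pointSchur (entryContents n A B S) (redPoints v.1) := by
  classical
  have h1 : pointSchur (entryContents n A B S) (greenPoints v.1) =
      (greenShape v.1 v.2.1).schur n := by
    rw [pointSchur, dif_pos v.2.1.card_greenPoints]
    refine SkewShape.partialSchur_eq_schur (A := greenShape v.1 v.2.1) fun k c => ?_
    exact Finset.mem_biUnion.2 ⟨v, Finset.mem_univ _, Finset.mem_union_left _
      (Finset.mem_image_of_mem _ (Finset.mem_univ (k, c)))⟩
  have h2 : pointSchur (entryContents n A B S) (redPoints v.1) =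
      (redShape v.1 v.2.1).schur n := by
    rw [pointSchur, dif_pos v.2.1.card_redPoints]
    refine SkewShape.partialSchur_eq_schur (A := redShape v.1 v.2.1) fun k c => ?_
    exact Finset.mem_biUnion.2 ⟨v, Finset.mem_univ _, Finset.mem_union_right _
      (Finset.mem_image_of_mem _ (Finset.mem_univ (k, c)))⟩
  rw [h1, h2, schurProduct]

theorem schurSum_eq (hS : S.Nonempty) (Z : (recolouringGraph A B S).ConnectedComponent) (n : ℕ) :
    schurSum n (Z.supp ∩ orientedClass A B S .inward) =
      schurSum n (Z.supp ∩ orientedClass A B S .outward) := by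
  classical
  have h := sum_eq_of_mem_planarSpan hS Z (isPlanarPairing_pointSchur (entryContents n A B S)
    (uncoloured A B) (coloured A B) (disjoint_uncoloured_coloured A B))
  simp only [greenSide_extend, redSide_extend, ← schurProduct_eq] at h
  unfold schurSum
  convert h

theorem isBipartiteWith_recolouringGraph (hS : S.Nonempty) :
    (recolouringGraph A B S).IsBipartiteWith
      (orientedClass A B S .inward) (orientedClass A B S .outward) where
  disjoint := by
    rw [Set.disjoint_left]
    intro v h1 h2
    obtain ⟨p, hp⟩ := hS
    have := (h1 p hp).symm.trans (h2 p hp)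
    simp at this
  mem_of_adj := by
    have key : ∀ v w : Vertex A B S, (∃ m, IsNoncrossingMatching v.1 m ∧
        w.1 = reverseEdges S m v.1) →
        v ∈ orientedClass A B S .inward ∧ w ∈ orientedClass A B S .outward ∨
        v ∈ orientedClass A B S .outward ∧ w ∈ orientedClass A B S .inward := by
      rintro v w ⟨m, hm, hw⟩
      obtain rfl : w = v.recolour hm := Subtype.ext hw
      obtain ⟨o, ho⟩ := v.2.2
      cases o
      · exact Or.inl ⟨ho, Vertex.recolour_mem_orientedClass hm ho⟩
      · exact Or.inr ⟨ho, Vertex.recolour_mem_orientedClass hm ho⟩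
    intro v w h
    rw [recolouringGraph, SimpleGraph.fromRel_adj] at h
    rcases h.2 with h | h
    · exact key v w h
    · have := key w v h
      tauto

end DodgsonScheme

open DodgsonScheme in
theorem mainTheorem6 (A B : SkewShape) (S : Finset (coloured A B)) (hS : S.Nonempty)
    (hsame : ∃ o, ∀ p ∈ S, initialOrientation A B p = o) :
    orientedClass A B S .inward ∪ orientedClass A B S .outward = Set.univ ∧
    (recolouringGraph A B S).IsBipartiteWith
      (orientedClass A B S .inward) (orientedClass A B S .outward) ∧
    ∀ Z : (recolouringGraph A B S).ConnectedComponent, Z.supp.Nontrivial →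
      (Z.supp ∩ orientedClass A B S .inward).Nonempty ∧
      (Z.supp ∩ orientedClass A B S .outward).Nonempty ∧
      ∀ n : ℕ, schurSum n (Z.supp ∩ orientedClass A B S .inward) =
        schurSum n (Z.supp ∩ orientedClass A B S .outward) := by
  refine ⟨?_, isBipartiteWith_recolouringGraph hS, fun Z hZ => ?_⟩
  · rw [Set.eq_univ_iff_forall]
    intro v
    obtain ⟨o, ho⟩ := v.2.2
    cases o
    · exact Or.inl ho
    · exact Or.inr ho
  · -- a component with two vertices contains an edge, and its ends lie in different classes
    obtain ⟨v, hv, w, hw, hvw⟩ := hZ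
    obtain ⟨p⟩ := SimpleGraph.ConnectedComponent.exact (hv.trans hw.symm)
    have hadj := p.adj_snd (SimpleGraph.Walk.not_nil_of_ne hvw)
    have hs := Z.mem_supp_of_adj_mem_supp hv hadj
    rcases (isBipartiteWith_recolouringGraph hS).mem_of_adj hadj with h | h
    · exact ⟨⟨v, hv, h.1⟩, ⟨_, hs, h.2⟩, schurSum_eq hS Z⟩
    · exact ⟨⟨_, hs, h.2⟩, ⟨v, hv, h.1⟩, schurSum_eq hS Z⟩
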